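/- Let $\mathsf{LOG}$ be a logic given by a sequent calculus on sequents $\Gamma\vdash\Delta$ of finite multisets of formulas (formulas being written as words; weakening may or may not be among its rules, i.e. $\mathsf{LOG}$ may be linear or affine), for example MLL, MALL, their affine or their intuitionistic variants. An individual resource game $G$ consists of players $1,\dots,n$, and for each player $i$ a goal formula $\gamma_i$ and an endowment $\epsilon_i$, a finite multiset of formulas. A profile is a tuple $P=(C_1,\dots,C_n)$ of multisets $C_i\subseteq\epsilon_i$; its outcome $\mathsf{out}(P)$ is the multiset union $\biguplus_i C_i$. With dichotomous preferences, player $i$ strongly prefers $P$ over $Q$ if $\mathsf{out}(P)\vdash\gamma_i$ is provable in $\mathsf{LOG}$ and $\mathsf{out}(Q)\vdash\gamma_i$ is not. $P$ is a Nash equilibrium of $G$ if there are no player $i$ and $C\subseteq\epsilon_i$ such that $i$ strongly prefers $(P_{-i},C)$ over $P$. The problem NE asks, given a game $G$ and a profile $P$ of $G$, whether $P$ is a Nash equilibrium of $G$. Sequent validity is the problem whether a given sequent $\Gamma\vdash\Delta$ is provable in $\mathsf{LOG}$. Let $\mathsf{BH_2}=\mathsf{NP}\wedge\mathsf{coNP}=\{L_1\cap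 L_2 : L_1\in\mathsf{NP},\ L_2\in\mathsf{coNP}\}$, let $\mathsf{NP}^{\mathsf C}$ be the class of languages decided by nondeterministic polynomial-time oracle machines with an oracle from $\mathsf C$, let $\mathsf{coNP}^{\mathsf C}$ be the class of the complements of the languages in $\mathsf{NP}^{\mathsf C}$, and let $\Pi_2^p$ be the class of the complements of the languages in $\Sigma_2^p=\mathsf{NP}^{\mathsf{NP}}$. Proposition. (1) If sequent validity in $\mathsf{LOG}$ is in $\mathsf{NP}$, then NE with dichotomous preferences is in $\mathsf{coNP}^{\mathsf{BH_2}}$, and also in $\Pi_2^p$. (2) If sequent validity in $\mathsf{LOG}$ is in $\mathsf{PSPACE}$, then NE with dichotomous preferences is in $\mathsf{PSPACE}$. Here a decision problem is a yes/no question about (codes of) its instances; it belongs to a class of languages if some language of the class gives the correct answer on all codes of instances. -/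

import Mathlib

/-! ## Machines

An oracle Turing machine with finite control whose memory consists of binary stacks (a work tape is
a pair of stacks, as in Mathlib's model `Turing.TM2`).  Each control state carries one elementary
instruction, and executing one instruction is one step. The stacks are indexed by `ℕ`, but a machine
has finitely many states, so only finitely many stacks are ever touched. -/

/-- The instruction attached to a control state; `Q` is the type of states.
* `push k b q`: push the bit `b` on stack `k`, go to `q`;
* `pop k qe q0 q1`: if stack `k` is empty go to `qe`; otherwise remove its top bit and go to
  `q0` or `q1` according to that bit;
* `guess q0 q1`: go nondeterministically to `q0` or `q1`;
* `query k qn qy`: ask the oracle whether the word on stack `k` (read from the top) is in the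
  oracle set, and go to `qy` if it is and to `qn` if it is not;
* `accept`, `reject`: halt. -/
inductive Instr (Q : Type) : Type where
  | push (k : ℕ) (b : Bool) (q : Q)
  | pop (k : ℕ) (qe q0 q1 : Q)
  | guess (q0 q1 : Q)
  | query (k : ℕ) (qn qy : Q)
  | accept
  | reject

/-- A nondeterministic oracle machine. -/
structure Machine where
  Q : Type
  finite_states : Finite Q
  start : Q
  prog : Q → Instr Q

namespace Machine

structure Cfg (M : Machine) where
  state : M.Q
  stk : ℕ → List Bool

/-- Initially the input word is on stack `0`, its first letter on top; all other stacks are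
empty. -/
def init (M : Machine) (x : List Bool) : M.Cfg where
  state := M.start
  stk := Function.update (fun _ => []) 0 x

open Classical in
/-- One step with oracle set `A`; the bit `b` resolves the nondeterministic choice, if the current
instruction is one.  Halted configurations are left unchanged. -/
noncomputable def step (M : Machine) (A : Set (List Bool)) (b : Bool) (c : M.Cfg) : M.Cfg :=
  match M.prog c.state with
  | .push k a q => ⟨q, Function.update c.stk k (a :: c.stk k)⟩
  | .pop k qe q0 q1 =>
      match c.stk k with
      | [] => ⟨qe, c.stk⟩
      | false :: l => ⟨q0, Function.update c.stk k l⟩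
      | true :: l => ⟨q1, Function.update c.stk k l⟩
  | .guess q0 q1 => ⟨if b then q1 else q0, c.stk⟩
  | .query k qn qy => ⟨if c.stk k ∈ A then qy else qn, c.stk⟩
  | .accept => c
  | .reject => c

/-- The configuration after `t` steps on input `x` along the computation path `w` (the choice
available at time `t` is resolved by `w t`). -/
noncomputable def run (M : Machine) (A : Set (List Bool)) (w : ℕ → Bool) (x : List Bool) :
    ℕ → M.Cfg
  | 0 => M.init x
  | t + 1 => M.step A (w t) (run M A w x t)

def Accepting (M : Machine) (c : M.Cfg) : Prop := M.prog c.state = .accept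

def Halted (M : Machine) (c : M.Cfg) : Prop :=
  M.prog c.state = .accept ∨ M.prog c.state = .reject

def Deterministic (M : Machine) : Prop := ∀ q q0 q1, M.prog q ≠ .guess q0 q1

def QueryFree (M : Machine) : Prop := ∀ q k qn qy, M.prog q ≠ .query k qn qy

/-- `M` with oracle `A` decides `L` in polynomial time: for some polynomial `p`, all computation
paths on `x` halt within `p |x|` steps, and `x ∈ L` iff some path accepts. -/
def DecidesInPolyTime (M : Machine) (A L : Set (List Bool)) : Prop :=
  ∃ p : Polynomial ℕ, ∀ x : List Bool,
    (∀ w, M.Halted (M.run A w x (p.eval x.length))) ∧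
    (x ∈ L ↔ ∃ w, M.Accepting (M.run A w x (p.eval x.length)))

/-- `M` decides `L` in polynomial space (used for deterministic machines without oracle queries):
for some polynomial `p`, every computation on `x` halts and at no time is a stack
longer than `p |x|`, and `x ∈ L` iff `M` accepts `x`. -/
def DecidesInPolySpace (M : Machine) (L : Set (List Bool)) : Prop :=
  ∃ p : Polynomial ℕ, ∀ x : List Bool,
    (∀ w, ∃ t, M.Halted (M.run ∅ w x t)) ∧
    (∀ w t k, ((M.run ∅ w x t).stk k).length ≤ p.eval x.length) ∧
    (x ∈ L ↔ ∃ w t, M.Accepting (M.run ∅ w x t))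

end Machine

/-! ## Complexity classes (classes of languages over the binary alphabet) -/

namespace Complexity

abbrev LangClass : Type := Set (Set (List Bool))

def P : LangClass :=
  {L | ∃ M : Machine, M.Deterministic ∧ M.QueryFree ∧ M.DecidesInPolyTime ∅ L}

def NP : LangClass := {L | ∃ M : Machine, M.QueryFree ∧ M.DecidesInPolyTime ∅ L}

def PSPACE : LangClass :=
  {L | ∃ M : Machine, M.Deterministic ∧ M.QueryFree ∧ M.DecidesInPolySpace L}

/-- The class of the complements of the languages in `C`. -/
def co (C : LangClass) : LangClass := {L | Lᶜ ∈ C}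

/-- The class `NP^C`: nondeterministic polynomial time with an oracle from `C`. -/
def NPrel (C : LangClass) : LangClass := {L | ∃ A ∈ C, ∃ M : Machine, M.DecidesInPolyTime A L}

/-- The class `C₁ ∧ C₂` of intersections. -/
def conj (C₁ C₂ : LangClass) : LangClass := {L | ∃ L₁ ∈ C₁, ∃ L₂ ∈ C₂, L = L₁ ∩ L₂}

/-- The second level `NP ∧ coNP` of the Boolean hierarchy over `NP`. -/
def BH2 : LangClass := conj NP (co NP)

/-- The classes `Σᵢᵖ` of the polynomial hierarchy. -/
def SigmaP : ℕ → LangClass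
  | 0 => P
  | i + 1 => NPrel (SigmaP i)

/-- The classes `Πᵢᵖ` of the polynomial hierarchy. -/
def PiP (i : ℕ) : LangClass := co (SigmaP i)

end Complexity

/-- A decision problem: a yes/no question about instances that are presented by binary words.  An
instance may have several codes (a multiset may be listed in several orders), but every code
determines its instance. -/
structure DecisionProblem where
  Inst : Type
  codes : Inst → Set (List Bool)
  codes_nonempty : ∀ a, (codes a).Nonempty
  unambiguous : ∀ a b x, x ∈ codes a → x ∈ codes b → a = b
  yes : Set Inst

/-- The problem belongs to `C`: some language in `C` gives the correct answer on every code of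
every instance. -/
def DecisionProblem.InClass (p : DecisionProblem) (C : Complexity.LangClass) : Prop :=
  ∃ L ∈ C, ∀ a : p.Inst, ∀ x ∈ p.codes a, (x ∈ L ↔ a ∈ p.yes)

/-! ## Self-delimiting codes -/

namespace Coding

/-- Code of a list: every entry is preceded by the bit `true`, the end is marked by `false`. -/
def encList {α : Type} (f : α → List Bool) : List α → List Bool
  | [] => [false]
  | a :: l => true :: (f a ++ encList f l)

/-- Self-delimiting code of a binary word. -/
def encWord (s : List Bool) : List Bool := encList (fun b => [b]) s

/-- `f` is a prefix code. -/
def PrefixCode {α : Type} (f : α → List Bool) : Prop :=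
  ∀ a a' s s', f a ++ s = f a' ++ s' → a = a' ∧ s = s'

theorem PrefixCode.encList {α : Type} {f : α → List Bool} (hf : PrefixCode f) :
    PrefixCode (encList f) := by
  intro l
  induction l with
  | nil =>
    intro l' s s' h
    cases l' with
    | nil => simpa [Coding.encList] using h
    | cons a l' => simp [Coding.encList] at h
  | cons a l ih =>
    intro l' s s' h
    cases l' with
    | nil => simp [Coding.encList] at h
    | cons a' l' =>
      simp only [Coding.encList, List.cons_append, List.append_assoc, List.cons.injEq,
        true_and] at h
      obtain ⟨rfl, h2⟩ := hf _ _ _ _ h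
      obtain ⟨rfl, h3⟩ := ih _ _ _ h2
      exact ⟨rfl, h3⟩

theorem prefixCode_encWord : PrefixCode encWord := by
  apply PrefixCode.encList
  intro a a' s s' h
  simpa using h

theorem PrefixCode.append {α β : Type} {f : α → List Bool} {g : β → List Bool}
    (hf : PrefixCode f) (hg : PrefixCode g) :
    PrefixCode (fun p : α × β => f p.1 ++ g p.2) := by
  rintro ⟨a, b⟩ ⟨a', b'⟩ s s' h
  simp only [List.append_assoc] at h
  obtain ⟨rfl, h2⟩ := hf _ _ _ _ h
  obtain ⟨rfl, h3⟩ := hg _ _ _ _ h2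
  exact ⟨rfl, h3⟩

end Coding

/-! ## Logics given by a sequent calculus -/

/-- A sequent `Γ ⊢ Δ`, where `Γ` and `Δ` are finite multisets of formulas. -/
@[ext]
structure Sequent (F : Type) where
  left : Multiset F
  right : Multiset F

/-- An (instance of an) inference rule. -/
structure InferenceRule (F : Type) where
  premises : List (Sequent F)
  conclusion : Sequent F

/-- A logic `LOG`: its formulas, written as binary words, and the set of the instances
of the rules of its sequent calculus.  The exchange rule is built into the use of multisets;
weakening may be present (`LOG` is affine) or absent (`LOG` is linear). -/
structure SequentCalculus where
  Formula : Type
  code : Formula → List Bool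
  code_injective : Function.Injective code
  rules : Set (InferenceRule Formula)

namespace SequentCalculus

/-- A sequent is provable (valid) if it has a proof tree built with the rules of the logic. -/
inductive Provable (LOG : SequentCalculus) : Sequent LOG.Formula → Prop where
  | infer (r : InferenceRule LOG.Formula) (hr : r ∈ LOG.rules)
      (hp : ∀ s ∈ r.premises, Provable LOG s) : Provable LOG r.conclusion

/-- Self-delimiting code of a formula. -/
def encFormula (LOG : SequentCalculus) (φ : LOG.Formula) : List Bool :=
  Coding.encWord (LOG.code φ)

/-- Code of a list of formulas. -/
def encFormulas (LOG : SequentCalculus) (l : List LOG.Formula) : List Bool :=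
  Coding.encList LOG.encFormula l

theorem prefixCode_encFormula (LOG : SequentCalculus) : Coding.PrefixCode LOG.encFormula := by
  intro a a' s s' h
  obtain ⟨h1, h2⟩ := Coding.prefixCode_encWord _ _ _ _ h
  exact ⟨LOG.code_injective h1, h2⟩

theorem prefixCode_encFormulas (LOG : SequentCalculus) : Coding.PrefixCode LOG.encFormulas :=
  LOG.prefixCode_encFormula.encList

/-- The problem of sequent validity in `LOG`.  A sequent is coded by listing the formulas of
its left side and then those of its right side, each in any order. -/
def sequentValidity (LOG : SequentCalculus) : DecisionProblem where
  Inst := Sequent LOG.Formula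
  codes S := {x | ∃ l r : List LOG.Formula, (l : Multiset LOG.Formula) = S.left ∧
    (r : Multiset LOG.Formula) = S.right ∧ x = LOG.encFormulas l ++ LOG.encFormulas r}
  codes_nonempty S := ⟨_, S.left.toList, S.right.toList, by simp, by simp, rfl⟩
  unambiguous := by
    rintro S T x ⟨l, r, hl, hr, rfl⟩ ⟨l', r', hl', hr', h⟩
    obtain ⟨rfl, h2⟩ := LOG.prefixCode_encFormulas _ _ _ _ h
    obtain ⟨rfl, -⟩ := LOG.prefixCode_encFormulas r r' [] [] (congrArg (· ++ []) h2)
    exact Sequent.ext (hl.symm.trans hl') (hr.symm.trans hr')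
  yes := {S | LOG.Provable S}

end SequentCalculus

/-! ## Individual resource games -/

/-- An individual resource game with players `1, …, n`. -/
structure ResourceGame (LOG : SequentCalculus) where
  n : ℕ
  goal : Fin n → LOG.Formula
  endow : Fin n → Multiset LOG.Formula

namespace ResourceGame

variable {LOG : SequentCalculus}

/-- The actions of player `i`: the sub-multisets of the endowment of `i`. -/
def actions (G : ResourceGame LOG) (i : Fin G.n) : Set (Multiset LOG.Formula) :=
  {C | C ≤ G.endow i}

/-- The action profiles of the game. -/
def profiles (G : ResourceGame LOG) : Set (Fin G.n → Multiset LOG.Formula) :=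
  {P | ∀ i, P i ∈ G.actions i}

/-- The outcome of a profile: the multiset union (with multiplicities added) of the actions. -/
def outcome (G : ResourceGame LOG) (P : Fin G.n → Multiset LOG.Formula) : Multiset LOG.Formula :=
  ∑ i, P i

/-- The outcome of `P` satisfies the goal of player `i`. -/
def Satisfies (G : ResourceGame LOG) (P : Fin G.n → Multiset LOG.Formula) (i : Fin G.n) : Prop :=
  LOG.Provable ⟨G.outcome P, {G.goal i}⟩

/-- Dichotomous preferences: player `i` strongly prefers `P` over `R`. -/
def StronglyPrefers (G : ResourceGame LOG) (i : Fin G.n)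
    (P R : Fin G.n → Multiset LOG.Formula) : Prop :=
  G.Satisfies P i ∧ ¬ G.Satisfies R i

/-- The profile `P` is a Nash equilibrium: no player `i` has an action `C` such that `i` strongly
prefers the profile `(P₋ᵢ, C)` over `P`. -/
def IsNash (G : ResourceGame LOG) (P : Fin G.n → Multiset LOG.Formula) : Prop :=
  ∀ i, ∀ C ∈ G.actions i, ¬ G.StronglyPrefers i (Function.update P i C) P

end ResourceGame

/-- An instance of the problem NASH EQUILIBRIUM: a game together with one of its profiles. -/
structure NEInstance (LOG : SequentCalculus) where
  game : ResourceGame LOG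
  profile : Fin game.n → Multiset LOG.Formula
  profile_mem : profile ∈ game.profiles

namespace SequentCalculus

/-- Code of the data of one player: the goal, a list of the endowment, a list of the action. -/
def encPlayer (LOG : SequentCalculus)
    (d : LOG.Formula × List LOG.Formula × List LOG.Formula) : List Bool :=
  LOG.encFormula d.1 ++ (LOG.encFormulas d.2.1 ++ LOG.encFormulas d.2.2)

/-- The problem NASH EQUILIBRIUM (with dichotomous preferences).  The instance is coded player by
player, with the formulas of each multiset listed in any order. -/
def nashEquilibrium (LOG : SequentCalculus) : DecisionProblem where
  Inst := NEInstance LOG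
  codes I := {x | ∃ e c : Fin I.game.n → List LOG.Formula,
    (∀ i, (e i : Multiset LOG.Formula) = I.game.endow i) ∧
    (∀ i, (c i : Multiset LOG.Formula) = I.profile i) ∧
    x = Coding.encList LOG.encPlayer (List.ofFn fun i => (I.game.goal i, e i, c i))}
  codes_nonempty I := ⟨_, fun i => (I.game.endow i).toList, fun i => (I.profile i).toList,
    by simp, by simp, rfl⟩
  unambiguous := by
    rintro ⟨⟨n, g, ε⟩, P, hP⟩ ⟨⟨n', g', ε'⟩, P', hP'⟩ x ⟨e, c, he, hc, rfl⟩ ⟨e', c', he', hc', h⟩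
    have hpre : Coding.PrefixCode LOG.encPlayer :=
      LOG.prefixCode_encFormula.append
        (LOG.prefixCode_encFormulas.append LOG.prefixCode_encFormulas)
    obtain ⟨h, -⟩ := hpre.encList _ _ [] [] (congrArg (· ++ []) h)
    have hn : n = n' := by simpa using congrArg List.length h
    subst hn
    have h := List.ofFn_injective h
    have hg : g = g' := funext fun i => congrArg (fun d => d.1) (congrFun h i)
    have hε : ε = ε' := funext fun i => by
      have h1 : e i = e' i := congrArg (fun d => d.2.1) (congrFun h i)
      exact (he i).symm.trans ((congrArg _ h1).trans (he' i))
    have hPP : P = P' := funext fun i => by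
      have h1 : c i = c' i := congrArg (fun d => d.2.2) (congrFun h i)
      exact (hc i).symm.trans ((congrArg _ h1).trans (hc' i))
    subst hg hε hPP
    rfl
  yes := {I | I.game.IsNash I.profile}

end SequentCalculus

/-! ## Propositional linear logic

The main examples of the logics above: the fragments of Affine MALL, such as MALL and MLL,
their affine and their intuitionistic variants. -/

inductive LLFormula : Type where
  | atom (k : ℕ)
  | top
  | zero
  | one
  | bot
  | neg (A : LLFormula)
  | par (A B : LLFormula)
  | tensor (A B : LLFormula)
  | limp (A B : LLFormula)
  | andd (A B : LLFormula)
  | plus (A B : LLFormula)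

namespace LLFormula

/-- Polish notation: a tag of four bits for each connective, the indices of atoms in unary. -/
def code : LLFormula → List Bool
  | atom k => [false, false, false, false] ++ List.replicate k true ++ [false]
  | top => [false, false, false, true]
  | zero => [false, false, true, false]
  | one => [false, false, true, true]
  | bot => [false, true, false, false]
  | neg A => [false, true, false, true] ++ A.code
  | par A B => [false, true, true, false] ++ A.code ++ B.code
  | tensor A B => [false, true, true, true] ++ A.code ++ B.code
  | limp A B => [true, false, false, false] ++ A.code ++ B.code
  | andd A B => [true, false, false, true] ++ A.code ++ B.code
  | plus A B => [true, false, true, false] ++ A.code ++ B.code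

theorem replicate_prefix : ∀ (k k' : ℕ) (s s' : List Bool),
    List.replicate k true ++ false :: s = List.replicate k' true ++ false :: s' →
      k = k' ∧ s = s'
  | 0, 0, s, s', h => by simpa using h
  | 0, k' + 1, s, s', h => by simp [List.replicate_succ] at h
  | k + 1, 0, s, s', h => by simp [List.replicate_succ] at h
  | k + 1, k' + 1, s, s', h => by
    simp only [List.replicate_succ, List.cons_append, List.cons.injEq, true_and] at h
    obtain ⟨rfl, h2⟩ := replicate_prefix k k' s s' h
    exact ⟨rfl, h2⟩

theorem prefixCode_code : Coding.PrefixCode code := by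
  intro A
  induction A with
  | atom k =>
    intro B s s' h
    cases B <;> simp [code] at h
    obtain ⟨rfl, h2⟩ := replicate_prefix _ _ _ _ h
    exact ⟨rfl, h2⟩
  | top | zero | one | bot =>
    intro B s s' h
    cases B <;> simp [code] at h
    exact ⟨rfl, h⟩
  | neg A ih =>
    intro B s s' h
    cases B <;> simp [code] at h
    obtain ⟨rfl, h2⟩ := ih _ _ _ h
    exact ⟨rfl, h2⟩
  | par A A' ih ih' | tensor A A' ih ih' | limp A A' ih ih' | andd A A' ih ih'
  | plus A A' ih ih' =>
    intro B s s' h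
    cases B <;> simp [code] at h
    obtain ⟨rfl, h2⟩ := ih _ _ _ h
    obtain ⟨rfl, h3⟩ := ih' _ _ _ h2
    exact ⟨rfl, h3⟩

theorem code_injective : Function.Injective code := fun A B h =>
  (prefixCode_code A B [] [] (by rw [h])).1

end LLFormula

open LLFormula in
/-- The rules of MALL other than weakening, `rule premises Γ Δ` having conclusion `Γ ⊢ Δ`. -/
inductive MALLRule : List (Sequent LLFormula) → Multiset LLFormula → Multiset LLFormula → Prop where
  | ax (A) : MALLRule [] {A} {A}
  | cut (A Γ Δ Γ' Δ') : MALLRule [⟨A ::ₘ Γ, Δ⟩, ⟨Γ', A ::ₘ Δ'⟩] (Γ + Γ') (Δ + Δ')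
  | negL (A Γ Δ) : MALLRule [⟨Γ, A ::ₘ Δ⟩] (neg A ::ₘ Γ) Δ
  | negR (A Γ Δ) : MALLRule [⟨A ::ₘ Γ, Δ⟩] Γ (neg A ::ₘ Δ)
  | tensorR (A B Γ Δ Γ' Δ') :
      MALLRule [⟨Γ, A ::ₘ Δ⟩, ⟨Γ', B ::ₘ Δ'⟩] (Γ + Γ') (tensor A B ::ₘ (Δ + Δ'))
  | tensorL (A B Γ Δ) : MALLRule [⟨A ::ₘ B ::ₘ Γ, Δ⟩] (tensor A B ::ₘ Γ) Δ
  | parL (A B Γ Δ Γ' Δ') :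
      MALLRule [⟨A ::ₘ Γ, Δ⟩, ⟨B ::ₘ Γ', Δ'⟩] (par A B ::ₘ (Γ + Γ')) (Δ + Δ')
  | parR (A B Γ Δ) : MALLRule [⟨Γ, A ::ₘ B ::ₘ Δ⟩] Γ (par A B ::ₘ Δ)
  | limpL (A B Γ Δ Γ' Δ') :
      MALLRule [⟨Γ, A ::ₘ Δ⟩, ⟨B ::ₘ Γ', Δ'⟩] (limp A B ::ₘ (Γ + Γ')) (Δ + Δ')
  | limpR (A B Γ Δ) : MALLRule [⟨A ::ₘ Γ, B ::ₘ Δ⟩] Γ (limp A B ::ₘ Δ)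
  | oneL (Γ Δ) : MALLRule [⟨Γ, Δ⟩] (one ::ₘ Γ) Δ
  | oneR : MALLRule [] 0 {one}
  | botL : MALLRule [] {bot} 0
  | botR (Γ Δ) : MALLRule [⟨Γ, Δ⟩] Γ (bot ::ₘ Δ)
  | anddR (A B Γ Δ) : MALLRule [⟨Γ, A ::ₘ Δ⟩, ⟨Γ, B ::ₘ Δ⟩] Γ (andd A B ::ₘ Δ)
  | anddL0 (A B Γ Δ) : MALLRule [⟨A ::ₘ Γ, Δ⟩] (andd A B ::ₘ Γ) Δ
  | anddL1 (A B Γ Δ) : MALLRule [⟨B ::ₘ Γ, Δ⟩] (andd A B ::ₘ Γ) Δ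
  | plusL (A B Γ Δ) : MALLRule [⟨A ::ₘ Γ, Δ⟩, ⟨B ::ₘ Γ, Δ⟩] (plus A B ::ₘ Γ) Δ
  | plusR0 (A B Γ Δ) : MALLRule [⟨Γ, A ::ₘ Δ⟩] Γ (plus A B ::ₘ Δ)
  | plusR1 (A B Γ Δ) : MALLRule [⟨Γ, B ::ₘ Δ⟩] Γ (plus A B ::ₘ Δ)
  | topR (Γ Δ) : MALLRule [] Γ (top ::ₘ Δ)
  | zeroL (Γ Δ) : MALLRule [] (zero ::ₘ Γ) Δ

/-- The weakening rules. -/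
inductive WeakeningRule :
    List (Sequent LLFormula) → Multiset LLFormula → Multiset LLFormula → Prop where
  | left (A Γ Δ) : WeakeningRule [⟨Γ, Δ⟩] (A ::ₘ Γ) Δ
  | right (A Γ Δ) : WeakeningRule [⟨Γ, Δ⟩] Γ (A ::ₘ Δ)

def linearMALLRules : Set (InferenceRule LLFormula) :=
  {r | MALLRule r.premises r.conclusion.left r.conclusion.right}

def affineMALLRules : Set (InferenceRule LLFormula) :=
  linearMALLRules ∪ {r | WeakeningRule r.premises r.conclusion.left r.conclusion.right}

/-- The fragment with the formulas in `lang` and those rule instances in `R` in which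
only such formulas occur, where `R ⊆ affineMALLRules` (for instance `linearMALLRules`). -/
def llFragment (lang : Set LLFormula) (R : Set (InferenceRule LLFormula)) : SequentCalculus where
  Formula := lang
  code A := A.1.code
  code_injective := fun _ _ h => Subtype.ext (LLFormula.code_injective h)
  rules := {r | (⟨r.premises.map fun S => ⟨S.left.map Subtype.val, S.right.map Subtype.val⟩,
    ⟨r.conclusion.left.map Subtype.val, r.conclusion.right.map Subtype.val⟩⟩ :
      InferenceRule LLFormula) ∈ R}

/-! A profile is not a Nash equilibrium iff some player $i$ has an action $C \subseteq \epsilon_i$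
such that the outcome after the deviation proves $\gamma_i$ and the present outcome does not. Such a
pair is no longer than the code of the game, and it is checked with two questions about sequent
validity. Hence NE lies in $\mathsf{coNP}^{\mathsf C}$ for every class $\mathsf C$ containing
sequent validity: this is `Deviation.nashEquilibrium_inClass`, and everything else follows from it.

If validity is in NP, it is also in $\mathsf{BH_2}$ (intersect with the set of all words) and in
$\mathsf{NP}^{\mathsf P} = \Sigma_1^p$, which gives both bounds of (1). If validity is in PSPACE,
then NE is in $\mathsf{coNP}^{\mathsf{PSPACE}}$, which is contained in PSPACE by
`Complexity.co_NPrel_PSPACE_subset`.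

For the general bound, a finite transducer reads the code once, guesses the player and a sublist of
the endowment, and writes both outcomes and the goal. The relation `Trans` describes it without
machines, `trans_players` computes its outputs, `decides` realizes it by an oracle machine, and
`mem_language_iff` translates its outputs into deviations.

For the inclusion in PSPACE, the tree of choices of the oracle machine has polynomial depth and is
searched depth first. Only the choices of the current path are stored; after backtracking, the path
is rerun from the saved input. Queries are answered by running the oracle's machine on stacks of its
own, which are then erased. The core is `Answers.search`, an induction on the remaining depth. -/

/-! ## Runs from arbitrary configurations -/

namespace Machine

/-- The configuration reached from `c` after `t` steps along the computation path `w`. -/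
noncomputable def runFrom (M : Machine) (A : Set (List Bool)) (w : ℕ → Bool) (c : M.Cfg) :
    ℕ → M.Cfg
  | 0 => c
  | t + 1 => M.step A (w t) (runFrom M A w c t)

variable {M : Machine} {A : Set (List Bool)}

theorem run_eq_runFrom (w : ℕ → Bool) (x : List Bool) (t : ℕ) :
    M.run A w x t = M.runFrom A w (M.init x) t := by
  induction t with
  | zero => rfl
  | succ t ih => rw [run, runFrom, ih]

theorem runFrom_add (w : ℕ → Bool) (c : M.Cfg) (a b : ℕ) :
    M.runFrom A w c (a + b) = M.runFrom A (fun t => w (a + t)) (M.runFrom A w c a) b := by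
  induction b with
  | zero => rfl
  | succ b ih => rw [← add_assoc, runFrom, runFrom, ih]

theorem Accepting.halted {c : M.Cfg} (h : M.Accepting c) : M.Halted c := Or.inl h

theorem step_of_halted {c : M.Cfg} (h : M.Halted c) (b : Bool) : M.step A b c = c := by
  rcases h with h | h <;> simp only [step, h]

theorem runFrom_of_halted {c : M.Cfg} (h : M.Halted c) (w : ℕ → Bool) (t : ℕ) :
    M.runFrom A w c t = c := by
  induction t with
  | zero => rfl
  | succ t ih => rw [runFrom, ih, step_of_halted h]

theorem runFrom_of_le {w : ℕ → Bool} {c : M.Cfg} {s t : ℕ} (hst : s ≤ t)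
    (h : M.Halted (M.runFrom A w c s)) : M.runFrom A w c t = M.runFrom A w c s := by
  obtain ⟨d, rfl⟩ := Nat.exists_eq_add_of_le hst
  rw [runFrom_add, runFrom_of_halted h]

theorem step_push {q q' : M.Q} {k : ℕ} {a : Bool} (h : M.prog q = .push k a q') (b : Bool)
    (st : ℕ → List Bool) :
    M.step A b ⟨q, st⟩ = ⟨q', Function.update st k (a :: st k)⟩ := by
  simp only [step, h]

theorem step_pop_nil {q qe q0 q1 : M.Q} {k : ℕ} (h : M.prog q = .pop k qe q0 q1) (b : Bool)
    {st : ℕ → List Bool} (hk : st k = []) : M.step A b ⟨q, st⟩ = ⟨qe, st⟩ := by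
  simp only [step, h, hk]

theorem step_pop_cons {q qe q0 q1 : M.Q} {k : ℕ} (h : M.prog q = .pop k qe q0 q1) (b : Bool)
    {st : ℕ → List Bool} {a : Bool} {l : List Bool} (hk : st k = a :: l) :
    M.step A b ⟨q, st⟩ = ⟨bif a then q1 else q0, Function.update st k l⟩ := by
  cases a <;> simp only [step, h, hk, cond_true, cond_false]

theorem step_guess {q q0 q1 : M.Q} (h : M.prog q = .guess q0 q1) (b : Bool)
    (st : ℕ → List Bool) : M.step A b ⟨q, st⟩ = ⟨if b then q1 else q0, st⟩ := by
  simp only [step, h]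

open Classical in
theorem step_query {q qn qy : M.Q} {k : ℕ} (h : M.prog q = .query k qn qy) (b : Bool)
    (st : ℕ → List Bool) : M.step A b ⟨q, st⟩ = ⟨if st k ∈ A then qy else qn, st⟩ := by
  simp only [step, h]

/-! ### Bounds on the lengths and indices of the stacks in use -/

theorem length_step_le (b : Bool) (c : M.Cfg) {N : ℕ} (h : ∀ k, (c.stk k).length ≤ N) (k : ℕ) :
    ((M.step A b c).stk k).length ≤ N + 1 := by
  obtain ⟨q, st⟩ := c
  have hk := h k
  unfold step
  split
  · rename_i j a _ _
    have hj := h j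
    by_cases e : k = j
    · subst e; simpa using hk
    · simpa [e] using hk.trans (Nat.le_succ N)
  · rename_i j _ _ _ _
    have hj := h j
    split
    · exact hk.trans (Nat.le_succ N)
    all_goals
      rename_i heq
      by_cases e : k = j
      · subst e
        rw [heq, List.length_cons] at hj
        simp only [Function.update_self]
        omega
      · simpa [e] using hk.trans (Nat.le_succ N)
  all_goals exact hk.trans (Nat.le_succ N)

/-- Only stacks with index at most `K` are used. -/
def UsesUpTo (M : Machine) (K : ℕ) : Prop :=
  ∀ q, (∀ k b q', M.prog q = .push k b q' → k ≤ K) ∧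
    (∀ k qe q0 q1, M.prog q = .pop k qe q0 q1 → k ≤ K)

/-- Finitely many states name finitely many stacks. The bound allows a simulating machine to erase a
whole configuration under finite control. Queries may be ignored here, since they change no stack.
-/
theorem exists_usesUpTo (M : Machine) : ∃ K, M.UsesUpTo K := by
  have := M.finite_states
  let f : M.Q → ℕ := fun q => match M.prog q with
    | .push k _ _ => k
    | .pop k _ _ _ => k
    | _ => 0
  obtain ⟨K, hK⟩ := (Set.finite_range f).bddAbove
  refine ⟨K, fun q => ⟨fun k b q' h => ?_, fun k qe q0 q1 h => ?_⟩⟩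
  all_goals
    have := hK ⟨q, rfl⟩
    simpa only [f, h] using this

theorem UsesUpTo.step {K : ℕ} (hK : M.UsesUpTo K) (b : Bool) (c : M.Cfg)
    (h : ∀ k, K < k → c.stk k = []) (k : ℕ) (hk : K < k) : (M.step A b c).stk k = [] := by
  obtain ⟨q, st⟩ := c
  unfold Machine.step
  split
  · rename_i j a q' hq
    have := (hK _).1 _ _ _ hq
    have e : k ≠ j := by omega
    simpa [e] using h k hk
  · rename_i j _ _ _ hq
    have := (hK _).2 _ _ _ _ hq
    have e : k ≠ j := by omega
    split
    all_goals simpa [e] using h k hk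
  all_goals exact h k hk

/-! ### Finite sequences of choices -/

/-- The configuration reached from `c` along the finite sequence `u` of choices. -/
noncomputable def path (M : Machine) (A : Set (List Bool)) (c : M.Cfg) (u : List Bool) : M.Cfg :=
  u.foldl (fun c b => M.step A b c) c

theorem path_append (c : M.Cfg) (u v : List Bool) :
    M.path A c (u ++ v) = M.path A (M.path A c u) v := List.foldl_append

theorem path_concat (c : M.Cfg) (u : List Bool) (b : Bool) :
    M.path A c (u ++ [b]) = M.step A b (M.path A c u) := by
  rw [path_append]; rfl

theorem path_of_halted {c : M.Cfg} (h : M.Halted c) (u : List Bool) : M.path A c u = c := by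
  induction u using List.reverseRecOn with
  | nil => rfl
  | append_singleton u b ih => rw [path_concat, ih, step_of_halted h]

theorem runFrom_eq_path (w : ℕ → Bool) (c : M.Cfg) (t : ℕ) :
    M.runFrom A w c t = M.path A c ((List.range t).map w) := by
  induction t with
  | zero => rfl
  | succ t ih => rw [List.range_succ, List.map_append, List.map_singleton, path_concat, runFrom, ih]

theorem exists_runFrom_eq_path (c : M.Cfg) (u : List Bool) :
    ∃ w, M.runFrom A w c u.length = M.path A c u := by
  -- The default `false` is immaterial: choices beyond the end of `u` are not consulted in the first
  -- `u.length` steps.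
  refine ⟨fun i => u.getD i false, ?_⟩
  rw [runFrom_eq_path]
  congr 1
  apply List.ext_getElem <;> simp +contextual

theorem length_path_le (c : M.Cfg) {N : ℕ} (h : ∀ k, (c.stk k).length ≤ N) (u : List Bool) (k : ℕ) :
    ((M.path A c u).stk k).length ≤ N + u.length := by
  induction u using List.reverseRecOn generalizing k with
  | nil => exact h k
  | append_singleton u b ih =>
    rw [path_concat, List.length_append, List.length_singleton, ← add_assoc]
    exact length_step_le _ _ ih k

theorem UsesUpTo.path {K : ℕ} (hK : M.UsesUpTo K) (c : M.Cfg)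
    (h : ∀ k, K < k → c.stk k = []) (u : List Bool) (k : ℕ) (hk : K < k) :
    (M.path A c u).stk k = [] := by
  induction u using List.reverseRecOn generalizing k with
  | nil => exact h k hk
  | append_singleton u b ih =>
    rw [path_concat]
    exact hK.step _ _ ih k hk

theorem length_init_le (x : List Bool) (k : ℕ) : ((M.init x).stk k).length ≤ x.length := by
  by_cases h : k = 0
  · subst h; simp [init]
  · simp [init, h]

theorem init_stk_of_pos (x : List Bool) {k : ℕ} (hk : 0 < k) : (M.init x).stk k = [] := by
  simp [init, hk.ne']

end Machine

/-! ## Inclusions between the classes -/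

namespace Complexity

theorem empty_mem_P : (∅ : Set (List Bool)) ∈ P := by
  refine ⟨⟨Unit, inferInstance, (), fun _ => .reject⟩, ?_, ?_, 0, fun x => ⟨fun w => Or.inr rfl, ?_⟩⟩
  · intro q q0 q1 h; cases h
  · intro q k qn qy h; cases h
  · simp [Machine.Accepting]

theorem P_subset_NP : P ⊆ NP := fun _ ⟨M, _, h⟩ => ⟨M, h⟩

/-- `NP` is defined by machines run with the empty oracle, and the empty language is in `P`. -/
theorem NP_subset_NPrel_P : NP ⊆ NPrel P := fun _ ⟨M, _, h⟩ => ⟨∅, empty_mem_P, M, h⟩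

theorem NP_subset_BH2 : NP ⊆ BH2 := by
  intro L hL
  refine ⟨L, hL, Set.univ, ?_, (Set.inter_univ L).symm⟩
  change Set.univᶜ ∈ NP
  rw [Set.compl_univ]
  exact P_subset_NP empty_mem_P

end Complexity

/-! ## Guessing a deviation: a nondeterministic transducer -/

namespace Deviation

/-- The states in which the code of a game with a profile is read. `ch` tells whether the deviating
player has been chosen, `dev` whether the current player is the deviating one, and `cp` whether the
current formula is in the new action. -/
inductive Scan : Type
  | player (ch : Bool)
  | goalTag (ch dev : Bool)
  | goalBit (ch dev : Bool)
  | endowHd (ch dev : Bool)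
  | endowTag (ch dev cp : Bool)
  | endowBit (ch dev cp : Bool)
  | actHd (ch dev : Bool)
  | actTag (ch dev : Bool)
  | actBit (ch dev : Bool)
  | done (ch : Bool)
  | bad
deriving DecidableEq, Fintype

namespace Scan

/-- The next state when the bit `b` is read and `c` is guessed. -/
def next : Scan → Bool → Bool → Scan
  -- The guess `c` matters only here and at `endowHd`. Once `ch` holds, no later player can become
  -- the deviating one.
  | player ch, true, c => goalTag (ch || c) (!ch && c)
  | player ch, false, _ => done ch
  | goalTag ch dev, true, _ => goalBit ch dev
  | goalTag ch dev, false, _ => endowHd ch dev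
  | goalBit ch dev, _, _ => goalTag ch dev
  | endowHd ch dev, true, c => endowTag ch dev (dev && c)
  | endowHd ch dev, false, _ => actHd ch dev
  | endowTag ch dev cp, true, _ => endowBit ch dev cp
  | endowTag ch dev _, false, _ => endowHd ch dev
  | endowBit ch dev cp, _, _ => endowTag ch dev cp
  | actHd ch dev, true, _ => actTag ch dev
  | actHd ch _, false, _ => player ch
  | actTag ch dev, true, _ => actBit ch dev
  | actTag ch dev, false, _ => actHd ch dev
  | actBit ch dev, _, _ => actTag ch dev
  | done _, _, _ => bad
  | bad, _, _ => bad

/-- Whether the bit `b` just read is copied to the output `i`: output `0` receives the formulas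
of the outcome after the deviation, output `1` those of the given outcome, and output `2` the goal
of the deviating player. -/
def echo : Scan → Bool → Bool → Fin 3 → Bool
  | goalTag _ dev, _, _, 2 => dev
  | goalBit _ dev, _, _, 2 => dev
  -- The end marks of lists (`b = false`) are not copied, because the lists of several players are
  -- concatenated; `question` supplies a single end mark.
  | endowHd _ dev, b, c, 0 => b && (dev && c)
  | endowTag _ _ cp, _, _, 0 => cp
  | endowBit _ _ cp, _, _, 0 => cp
  | actHd _ dev, b, _, 0 => b && !dev
  | actHd _ _, b, _, 1 => b
  | actTag _ dev, _, _, 0 => !dev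
  | actTag _ _, _, _, 1 => true
  | actBit _ dev, _, _, 0 => !dev
  | actBit _ _, _, _, 1 => true
  | _, _, _, _ => false

end Scan

/-! ### The transduction relation and its outputs on codes of games -/

open Scan

/-- Reading `x` may lead from `s` to `s'` and produce the outputs `o`. -/
def Trans : Scan → List Bool → Scan → (Fin 3 → List Bool) → Prop
  | s, [], s', o => s' = s ∧ o = fun _ => []
  | s, b :: x, s', o => ∃ c o', Trans (s.next b c) x s' o' ∧
      o = fun i => (if s.echo b c i then [b] else []) ++ o' i

theorem trans_append {s s' : Scan} {x y : List Bool} {o : Fin 3 → List Bool} :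
    Trans s (x ++ y) s' o ↔
      ∃ m o₁ o₂, Trans s x m o₁ ∧ Trans m y s' o₂ ∧ o = fun i => o₁ i ++ o₂ i := by
  induction x generalizing s o with
  | nil =>
    constructor
    · intro h
      exact ⟨s, fun _ => [], o, ⟨rfl, rfl⟩, h, rfl⟩
    · rintro ⟨_, _, o₂, ⟨rfl, rfl⟩, h, rfl⟩
      exact h
  | cons b x ih =>
    simp only [List.cons_append, Trans, ih]
    constructor
    · rintro ⟨c, _, ⟨m, o₁, o₂, h₁, h₂, rfl⟩, rfl⟩
      exact ⟨m, _, o₂, ⟨c, o₁, h₁, rfl⟩, h₂, by simp⟩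
    · rintro ⟨m, _, o₂, ⟨c, o₁, h₁, rfl⟩, h₂, rfl⟩
      exact ⟨c, _, ⟨m, o₁, o₂, h₁, h₂, rfl⟩, by simp⟩

/-- A word is read by two alternating states, one for the continuation bits and one for the letters.
Both echo to the same outputs, end mark included, so each output receives the whole code or nothing,
and no guess has any effect. -/
theorem trans_encWord {tag bit nxt : Scan} {e : Fin 3 → Bool}
    (h1 : ∀ c, tag.next true c = bit) (h2 : ∀ b c, bit.next b c = tag)
    (h3 : ∀ c, tag.next false c = nxt) (h4 : ∀ b c, tag.echo b c = e)
    (h5 : ∀ b c, bit.echo b c = e) (w : List Bool) (s' : Scan) (o : Fin 3 → List Bool) :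
    Trans tag (Coding.encWord w) s' o ↔
      s' = nxt ∧ o = fun i => if e i then Coding.encWord w else [] := by
  induction w generalizing o with
  | nil =>
    simp [Coding.encWord, Coding.encList, Trans, h3, h4]
  | cons b w ih =>
    simp only [Coding.encWord] at ih
    simp only [Coding.encWord, Coding.encList, List.singleton_append, Trans, h1, h2, h4, h5, ih,
      exists_const]
    constructor
    · rintro ⟨_, ⟨_, ⟨rfl, rfl⟩, rfl⟩, rfl⟩
      exact ⟨rfl, funext fun i => by dsimp only; cases e i <;> rfl⟩
    · rintro ⟨rfl, rfl⟩
      exact ⟨_, ⟨_, ⟨rfl, rfl⟩, rfl⟩, funext fun i => by cases e i <;> rfl⟩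

variable {LOG : SequentCalculus}

/-- The code of a list of formulas without its end marker. -/
def items (l : List LOG.Formula) : List Bool := l.flatMap fun φ => true :: LOG.encFormula φ

theorem items_nil : items ([] : List LOG.Formula) = [] := rfl

theorem items_cons (φ : LOG.Formula) (l : List LOG.Formula) :
    items (φ :: l) = true :: (LOG.encFormula φ ++ items l) := by
  simp [items]

theorem items_append (l l' : List LOG.Formula) : items (l ++ l') = items l ++ items l' := by
  simp [items]

theorem encFormulas_eq (l : List LOG.Formula) : LOG.encFormulas l = items l ++ [false] := by
  induction l with
  | nil => rfl
  | cons φ l ih =>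
    rw [items_cons, SequentCalculus.encFormulas, Coding.encList, ← SequentCalculus.encFormulas, ih]
    simp

theorem trans_goal (ch dev : Bool) (φ : LOG.Formula) (s' : Scan) (o : Fin 3 → List Bool) :
    Trans (goalTag ch dev) (LOG.encFormula φ) s' o ↔
      s' = endowHd ch dev ∧ o = ![[], [], if dev then LOG.encFormula φ else []] := by
  rw [SequentCalculus.encFormula, trans_encWord (bit := goalBit ch dev) (nxt := endowHd ch dev)
    (e := ![false, false, dev])]
  · have : (fun i : Fin 3 => if ![false, false, dev] i then Coding.encWord (LOG.code φ) else []) =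
      ![[], [], if dev then Coding.encWord (LOG.code φ) else []] := by
      funext i; fin_cases i <;> cases dev <;> rfl
    rw [this]
  all_goals
    intros
    first
    | rfl
    | funext i; fin_cases i <;> rfl

theorem trans_endow_formula (ch dev cp : Bool) (φ : LOG.Formula) (s' : Scan)
    (o : Fin 3 → List Bool) :
    Trans (endowTag ch dev cp) (LOG.encFormula φ) s' o ↔
      s' = endowHd ch dev ∧ o = ![if cp then LOG.encFormula φ else [], [], []] := by
  rw [SequentCalculus.encFormula, trans_encWord (bit := endowBit ch dev cp) (nxt := endowHd ch dev)
    (e := ![cp, false, false])]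
  · have : (fun i : Fin 3 => if ![cp, false, false] i then Coding.encWord (LOG.code φ) else []) =
      ![if cp then Coding.encWord (LOG.code φ) else [], [], []] := by
      funext i; fin_cases i <;> cases cp <;> rfl
    rw [this]
  all_goals
    intros
    first
    | rfl
    | funext i; fin_cases i <;> rfl

theorem trans_action_formula (ch dev : Bool) (φ : LOG.Formula) (s' : Scan)
    (o : Fin 3 → List Bool) :
    Trans (actTag ch dev) (LOG.encFormula φ) s' o ↔
      s' = actHd ch dev ∧
        o = ![if dev then [] else LOG.encFormula φ, LOG.encFormula φ, []] := by
  rw [SequentCalculus.encFormula, trans_encWord (bit := actBit ch dev) (nxt := actHd ch dev)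
    (e := ![!dev, true, false])]
  · have : (fun i : Fin 3 => if ![!dev, true, false] i then Coding.encWord (LOG.code φ) else []) =
      ![if dev then [] else Coding.encWord (LOG.code φ), Coding.encWord (LOG.code φ), []] := by
      funext i; fin_cases i <;> cases dev <;> rfl
    rw [this]
  all_goals
    intros
    first
    | rfl
    | funext i; fin_cases i <;> rfl

theorem trans_actions (ch dev : Bool) (l : List LOG.Formula) (s' : Scan)
    (o : Fin 3 → List Bool) :
    Trans (actHd ch dev) (LOG.encFormulas l) s' o ↔
      s' = player ch ∧ o = ![if dev then [] else items l, items l, []] := by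
  induction l generalizing o with
  | nil =>
    have : ∀ c, (fun i => (if (actHd ch dev).echo false c i then [false] else []) ++ []) =
        (![[], [], []] : Fin 3 → List Bool) := by
      intro c; funext i; fin_cases i <;> rfl
    simp only [items_nil, ite_self]
    constructor
    · rintro ⟨c, _, ⟨rfl, rfl⟩, rfl⟩
      exact ⟨rfl, this c⟩
    · rintro ⟨rfl, rfl⟩
      exact ⟨true, _, ⟨rfl, rfl⟩, (this true).symm⟩
  | cons φ l ih =>
    simp only [SequentCalculus.encFormulas] at ih
    simp only [SequentCalculus.encFormulas, Coding.encList, Trans, next, trans_append,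
      trans_action_formula, items_cons]
    have key : ∀ c, (fun i => (if (actHd ch dev).echo true c i then [true] else []) ++
        (![if dev then [] else LOG.encFormula φ, LOG.encFormula φ, []] i ++
          ![if dev then [] else items l, items l, []] i)) =
        ![if dev then [] else true :: (LOG.encFormula φ ++ items l),
          true :: (LOG.encFormula φ ++ items l), []] := by
      intro c; funext i; fin_cases i <;> cases dev <;> rfl
    constructor
    · rintro ⟨c, _, ⟨_, _, _, ⟨rfl, rfl⟩, h, rfl⟩, rfl⟩
      obtain ⟨rfl, rfl⟩ := (ih _).1 h
      exact ⟨rfl, key c⟩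
    · rintro ⟨rfl, rfl⟩
      exact ⟨true, _, ⟨_, _, _, ⟨rfl, rfl⟩, (ih _).2 ⟨rfl, rfl⟩, rfl⟩, (key true).symm⟩

/-- One guess per formula decides whether it joins the new action, so the possible outputs are the
sublists of the endowment. For a player who does not deviate, the conjunction with `dev` suppresses
every copy. -/
theorem trans_endowment (ch dev : Bool) (l : List LOG.Formula) (s' : Scan)
    (o : Fin 3 → List Bool) :
    Trans (endowHd ch dev) (LOG.encFormulas l) s' o ↔
      s' = actHd ch dev ∧ ∃ l', l'.Sublist l ∧ (dev = false → l' = []) ∧ o = ![items l', [], []] := by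
  induction l generalizing o with
  | nil =>
    have : ∀ c, (fun i => (if (endowHd ch dev).echo false c i then [false] else []) ++ []) =
        (![[], [], []] : Fin 3 → List Bool) := by
      intro c; funext i; fin_cases i <;> rfl
    constructor
    · rintro ⟨c, _, ⟨rfl, rfl⟩, rfl⟩
      exact ⟨rfl, [], List.Sublist.refl _, fun _ => rfl, this c⟩
    · rintro ⟨rfl, l', hl, -, rfl⟩
      cases hl
      exact ⟨true, _, ⟨rfl, rfl⟩, (this true).symm⟩
  | cons φ l ih =>
    simp only [SequentCalculus.encFormulas] at ih
    simp only [SequentCalculus.encFormulas, Coding.encList, Trans, next, trans_append,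
      trans_endow_formula]
    have key : ∀ (c : Bool) (l' : List LOG.Formula),
        (fun i => (if (endowHd ch dev).echo true c i then [true] else []) ++
        (![if dev && c then LOG.encFormula φ else [], [], []] i ++ ![items l', [], []] i)) =
        ![items (if dev && c then φ :: l' else l'), [], []] := by
      intro c l'; funext i; fin_cases i <;> cases dev <;> cases c <;> simp [items_cons, echo]
    constructor
    · rintro ⟨c, _, ⟨_, _, _, ⟨rfl, rfl⟩, h, rfl⟩, rfl⟩
      obtain ⟨rfl, l', hl, hd, rfl⟩ := (ih _).1 h
      refine ⟨rfl, _, ?_, ?_, key c l'⟩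
      · split
        · exact hl.cons_cons φ
        · exact hl.cons φ
      · rintro rfl
        simpa using hd
    · rintro ⟨rfl, l', hl, hd, rfl⟩
      have : ∃ c l'', l' = (if dev && c then φ :: l'' else l'') ∧ l''.Sublist l ∧
          (dev = false → l'' = []) := by
        cases hl with
        | cons _ h => exact ⟨false, l', by simp, h, hd⟩
        | cons_cons _ h =>
          cases dev with
          | false => simp at hd
          | true => exact ⟨true, _, by simp, h, by simp⟩
      obtain ⟨c, l'', rfl, h, hd'⟩ := this
      exact ⟨c, _, ⟨_, _, _, ⟨rfl, rfl⟩, (ih _).2 ⟨rfl, l'', h, hd', rfl⟩, rfl⟩, (key c l'').symm⟩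

theorem trans_player (ch dev : Bool) (d : LOG.Formula × List LOG.Formula × List LOG.Formula)
    (s' : Scan) (o : Fin 3 → List Bool) :
    Trans (goalTag ch dev) (LOG.encPlayer d) s' o ↔
      s' = player ch ∧ ∃ l', l'.Sublist d.2.1 ∧ (dev = false → l' = []) ∧
        o = ![if dev then items l' else items d.2.2, items d.2.2,
          if dev then LOG.encFormula d.1 else []] := by
  obtain ⟨φ, e, a⟩ := d
  simp only [SequentCalculus.encPlayer, trans_append, trans_goal]
  -- Output `0` is fed by the endowment and by the action, but one of the two contributions is
  -- always empty.
  have key : ∀ l' : List LOG.Formula, (dev = false → l' = []) →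
      (fun i => ![[], [], if dev then LOG.encFormula φ else []] i ++
        (![items l', [], []] i ++ ![if dev then [] else items a, items a, []] i)) =
      ![if dev then items l' else items a, items a, if dev then LOG.encFormula φ else []] := by
    intro l' hl
    funext i
    cases dev
    · rw [hl rfl]; fin_cases i <;> simp [items_nil]
    · fin_cases i <;> simp
  constructor
  · rintro ⟨_, _, _, ⟨rfl, rfl⟩, ⟨_, _, _, h₁, h₂, rfl⟩, rfl⟩
    obtain ⟨rfl, l', hl, hd, rfl⟩ := (trans_endowment _ _ _ _ _).1 h₁
    obtain ⟨rfl, rfl⟩ := (trans_actions _ _ _ _ _).1 h₂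
    exact ⟨rfl, l', hl, hd, key l' hd⟩
  · rintro ⟨rfl, l', hl, hd, rfl⟩
    exact ⟨_, _, _, ⟨rfl, rfl⟩, ⟨_, _, _, (trans_endowment _ _ _ _ _).2 ⟨rfl, l', hl, hd, rfl⟩,
      (trans_actions _ _ _ _ _).2 ⟨rfl, rfl⟩, rfl⟩, (key l' hd).symm⟩

/-- After the deviating player has been fixed, all further actions go unchanged into both outcomes
and the guesses have no effect. -/
theorem trans_players_chosen (ds : List (LOG.Formula × List LOG.Formula × List LOG.Formula))
    (s' : Scan) (o : Fin 3 → List Bool) :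
    Trans (player true) (Coding.encList LOG.encPlayer ds) s' o ↔
      s' = done true ∧
        o = ![items (ds.map (·.2.2)).flatten, items (ds.map (·.2.2)).flatten, []] := by
  induction ds generalizing o with
  | nil =>
    have : ∀ c, (fun i => (if (player true).echo false c i then [false] else []) ++ []) =
        (![[], [], []] : Fin 3 → List Bool) := by
      intro c; funext i; fin_cases i <;> rfl
    constructor
    · rintro ⟨c, _, ⟨rfl, rfl⟩, rfl⟩
      exact ⟨rfl, this c⟩
    · rintro ⟨rfl, rfl⟩
      exact ⟨true, _, ⟨rfl, rfl⟩, (this true).symm⟩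
  | cons d ds ih =>
    simp only [Coding.encList, Trans, next, trans_append, trans_player, List.map_cons,
      List.flatten_cons, items_append, Bool.true_or, Bool.not_true, Bool.false_and]
    have key : ∀ c, (fun i => (if (player true).echo true c i then [true] else []) ++
        (![if false = true then items ([] : List LOG.Formula) else items d.2.2, items d.2.2,
          if false = true then LOG.encFormula d.1 else []] i ++
          ![items (ds.map (·.2.2)).flatten, items (ds.map (·.2.2)).flatten, []] i)) =
        ![items d.2.2 ++ items (ds.map (·.2.2)).flatten,
          items d.2.2 ++ items (ds.map (·.2.2)).flatten, []] := by
      intro c; funext i; fin_cases i <;> rfl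
    constructor
    · rintro ⟨c, _, ⟨_, _, _, ⟨rfl, l', -, hl, rfl⟩, h, rfl⟩, rfl⟩
      obtain ⟨rfl, rfl⟩ := (ih _).1 h
      cases hl trivial
      exact ⟨rfl, key c⟩
    · rintro ⟨rfl, rfl⟩
      exact ⟨true, _, ⟨_, _, _, ⟨rfl, [], List.nil_sublist _, fun _ => rfl, rfl⟩,
        (ih _).2 ⟨rfl, rfl⟩, rfl⟩, (key true).symm⟩

/-- The end state `done true` forces exactly one player to deviate, namely the first one at which
the guess is `true`. -/
theorem trans_players (ds : List (LOG.Formula × List LOG.Formula × List LOG.Formula))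
    (o : Fin 3 → List Bool) :
    Trans (player false) (Coding.encList LOG.encPlayer ds) (done true) o ↔
      ∃ (i : ℕ) (hi : i < ds.length) (l' : List LOG.Formula), l'.Sublist ds[i].2.1 ∧
        o = ![items ((ds.map (·.2.2)).set i l').flatten, items (ds.map (·.2.2)).flatten,
          LOG.encFormula ds[i].1] := by
  induction ds generalizing o with
  | nil => simp [Coding.encList, Trans, next]
  | cons d ds ih =>
    simp only [Coding.encList, Trans, next, trans_append, trans_player, Bool.false_or,
      Bool.not_false, Bool.true_and]
    constructor
    · rintro ⟨c, _, ⟨_, _, _, ⟨rfl, l', hl, hd, rfl⟩, h, rfl⟩, rfl⟩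
      cases c with
      | false =>
        obtain ⟨i, hi, l, hl, rfl⟩ := (ih _).1 h
        refine ⟨i + 1, by simpa using hi, l, hl, funext fun j => ?_⟩
        fin_cases j <;> simp [items_append, echo]
      | true =>
        obtain ⟨-, rfl⟩ := (trans_players_chosen _ _ _).1 h
        refine ⟨0, by simp, l', hl, funext fun j => ?_⟩
        fin_cases j <;> simp [items_append, echo]
    · rintro ⟨i, hi, l', hl, rfl⟩
      cases i with
      | zero =>
        refine ⟨true, _, ⟨_, _, _, ⟨rfl, l', hl, by simp, rfl⟩,
          (trans_players_chosen _ _ _).2 ⟨rfl, rfl⟩, rfl⟩, funext fun j => ?_⟩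
        fin_cases j <;> simp [items_append, echo]
      | succ i =>
        refine ⟨false, _, ⟨_, _, _, ⟨rfl, [], List.nil_sublist _, by simp, rfl⟩,
          (ih _).2 ⟨i, by simpa using hi, l', hl, rfl⟩, rfl⟩, funext fun j => ?_⟩
        fin_cases j <;> simp [items_append, echo]

/-- Each letter read is copied at most once to each output. This makes the assembly of the questions
take linear time. -/
theorem Trans.length_le {s s' : Scan} {x : List Bool} {o : Fin 3 → List Bool}
    (h : Trans s x s' o) (i : Fin 3) : (o i).length ≤ x.length := by
  induction x generalizing s o with
  | nil => obtain ⟨-, rfl⟩ := h; simp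
  | cons b x ih =>
    obtain ⟨c, o', h', rfl⟩ := h
    have := ih h'
    simp only [List.length_append, List.length_cons]
    split <;> simp <;> omega

end Deviation

/-! ## The machine that looks for a deviation -/

namespace Deviation

open Scan

/-- The states of the machine that looks for a profitable deviation. -/
inductive State : Type
  | scan (s : Scan)
  | pick (s : Scan) (b : Bool)
  | emit (s : Scan) (b c : Bool) (i : Fin 3)
  | close (i : Fin 2)
  | goal
  | goalCopy (b : Bool) (i : Fin 2)
  | separate (b : Bool) (i : Fin 2)
  | moveFirst
  | moveFirstPush (b : Bool)
  | moveSecond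
  | moveSecondPush (b : Bool)
  | askFirst
  | askSecond
  | acc
  | rej
deriving DecidableEq, Fintype

open State

/-- The machine that looks for a profitable deviation: it reads the code of a game with a profile
on stack `0`, guessing a player and a new action of that player, and asks whether the outcome
satisfies the goal of that player after the deviation and before it. -/
def machine : Machine where
  Q := State
  finite_states := inferInstance
  start := scan (player false)
  prog
    | scan s => .pop 0 (if s = done true then close 0 else rej) (pick s false) (pick s true)
    | pick s b => .guess (emit s b false 0) (emit s b true 0)
    | emit s b c i =>
        let q := if i = 2 then scan (s.next b c) else emit s b c (i + 1)
        -- `guess q q` is an idle step, so that an emission takes one step whether or not it writes.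
        if s.echo b c i then .push (i + 1) b q else .guess q q
    -- The two questions are built on the stacks `4` and `5` from the last letter to the first: end
    -- mark, goal, the bits `true` and `false`, formulas of the outcome. The outputs lie reversed on
    -- their stacks, so that popping them onto the questions restores their order.
    | close i => .push (i + 4) false (if i = 1 then goal else close 1)
    | goal => .pop 3 (separate true 0) (goalCopy false 0) (goalCopy true 0)
    | goalCopy b i => .push (i + 4) b (if i = 1 then goal else goalCopy b 1)
    | separate b i => .push (i + 4) b
        (if i = 0 then separate b 1 else if b then separate false 0 else moveFirst)
    | moveFirst => .pop 1 moveSecond (moveFirstPush false) (moveFirstPush true)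
    | moveFirstPush b => .push 4 b moveFirst
    | moveSecond => .pop 2 askFirst (moveSecondPush false) (moveSecondPush true)
    | moveSecondPush b => .push 5 b moveSecond
    | askFirst => .query 4 rej askSecond
    | askSecond => .query 5 acc rej
    | acc => .accept
    | rej => .reject

/-! ### Stack contents and running times of the deviation machine -/

/-- The contents of the six stacks of the machine. -/
def store (x : List Bool) (o : Fin 3 → List Bool) (y z : List Bool) : ℕ → List Bool
  | 0 => x
  | 1 => o 0
  | 2 => o 1
  | 3 => o 2
  | 4 => y
  | 5 => z
  | _ => []

theorem update_store_zero (x o y z l) :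
    Function.update (store x o y z) 0 l = store l o y z := by
  funext k; rcases k with _ | _ | _ | _ | _ | _ | k <;> rfl

theorem update_store_out (x o y z l) (i : Fin 3) :
    Function.update (store x o y z) (i + 1) l = store x (Function.update o i l) y z := by
  fin_cases i <;> (funext k; rcases k with _ | _ | _ | _ | _ | _ | k <;> rfl)

theorem store_out (x o y z) (i : Fin 3) : store x o y z (i + 1) = o i := by
  fin_cases i <;> rfl

theorem update_store_four (x o y z l) :
    Function.update (store x o y z) 4 l = store x o l z := by
  funext k; rcases k with _ | _ | _ | _ | _ | _ | k <;> rfl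

theorem update_store_five (x o y z l) :
    Function.update (store x o y z) 5 l = store x o y l := by
  funext k; rcases k with _ | _ | _ | _ | _ | _ | k <;> rfl

/-- The configuration with the state `q` and the given contents of the stacks. -/
def cfg (q : State) (x : List Bool) (o : Fin 3 → List Bool) (y z : List Bool) : machine.Cfg :=
  ⟨q, store x o y z⟩

variable {A : Set (List Bool)}

theorem step_push_four {q q' : State} {b : Bool} (h : machine.prog q = .push 4 b q') (d : Bool)
    (x o y z) : machine.step A d (cfg q x o y z) = cfg q' x o (b :: y) z :=
  (Machine.step_push h _ _).trans (congrArg (Machine.Cfg.mk _) (update_store_four _ _ _ _ _))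

theorem step_push_five {q q' : State} {b : Bool} (h : machine.prog q = .push 5 b q') (d : Bool)
    (x o y z) : machine.step A d (cfg q x o y z) = cfg q' x o y (b :: z) :=
  (Machine.step_push h _ _).trans (congrArg (Machine.Cfg.mk _) (update_store_five _ _ _ _ _))

theorem step_pop_out {q qe : State} {f : Bool → State} {i : Fin 3} {b : Bool} {l : List Bool}
    (h : machine.prog q = .pop (i + 1) qe (f false) (f true)) (d : Bool)
    (x o y z) (ho : o i = b :: l) :
    machine.step A d (cfg q x o y z) = cfg (f b) x (Function.update o i l) y z := by
  rw [cfg, Machine.step_pop_cons h d ((store_out x o y z i).trans ho), update_store_out]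
  cases b <;> rfl

theorem step_emit (s : Scan) (b c d : Bool) (i : Fin 3) (x o y z) :
    machine.step A d (cfg (emit s b c i) x o y z) =
      cfg (if i = 2 then scan (s.next b c) else emit s b c (i + 1))
        x (Function.update o i ((if s.echo b c i then [b] else []) ++ o i)) y z := by
  by_cases h : s.echo b c i = true
  · rw [cfg, Machine.step_push (show machine.prog (emit s b c i) = _ from if_pos h), store_out,
      update_store_out, if_pos h]
    rfl
  · rw [cfg, Machine.step_guess (show machine.prog (emit s b c i) = _ from if_neg h), if_neg h]
    simp only [List.nil_append, Function.update_eq_self]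
    cases d <;> rfl

/-- The scanning phase processes one bit in five steps. -/
theorem runFrom_scan_cons (w : ℕ → Bool) (s : Scan) (b : Bool) (x o y z) :
    machine.runFrom A w (cfg (scan s) (b :: x) o y z) 5 =
      cfg (scan (s.next b (w 1)))
        x (fun i => (if s.echo b (w 1) i then [b] else []) ++ o i) y z := by
  have h1 : ∀ d, machine.step A d (cfg (scan s) (b :: x) o y z) = cfg (pick s b) x o y z := by
    intro d
    rw [cfg, Machine.step_pop_cons (show machine.prog (scan s) = _ from rfl) d (a := b) (l := x) rfl,
      update_store_zero]
    cases b <;> rfl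
  have h2 : ∀ d, machine.step A d (cfg (pick s b) x o y z) = cfg (emit s b d 0) x o y z := by
    intro d
    rw [cfg, Machine.step_guess (show machine.prog (pick s b) = _ from rfl)]
    cases d <;> rfl
  have e0 : ((0 : Fin 3) = 2) = False := by simp
  have e1 : ((0 : Fin 3) + 1 = 2) = False := by simp
  have e2 : ((0 : Fin 3) + 1 + 1 = 2) = True := by simp
  simp only [Machine.runFrom, h1, h2, step_emit, e0, e1, e2, if_false, if_true]
  congr 1
  funext i
  fin_cases i <;> rfl

/-- Of the five choices spent on a letter only the second is consulted, and it acts as the guess in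
`Trans`. The outputs appear reversed because they are pushed. `Trans.exists_runFrom` is the
converse. -/
theorem runFrom_scan (w : ℕ → Bool) (s : Scan) (x : List Bool) (o : Fin 3 → List Bool) :
    ∃ s' o', Trans s x s' o' ∧
      machine.runFrom A w (cfg (scan s) x o [] []) (5 * x.length) =
        cfg (scan s') [] (fun i => (o' i).reverse ++ o i) [] [] := by
  induction x generalizing w s o with
  | nil => exact ⟨s, fun _ => [], ⟨rfl, rfl⟩, rfl⟩
  | cons b x ih =>
    obtain ⟨s', o', h, e⟩ := ih (fun t => w (5 + t)) (s.next b (w 1))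
      (fun i => (if s.echo b (w 1) i then [b] else []) ++ o i)
    refine ⟨s', _, ⟨w 1, o', h, rfl⟩, ?_⟩
    rw [List.length_cons, mul_add, mul_one, add_comm, Machine.runFrom_add, runFrom_scan_cons, e]
    congr 1
    funext i
    split <;> simp

theorem Trans.exists_runFrom {s s' : Scan} {x : List Bool} {o' : Fin 3 → List Bool}
    (h : Trans s x s' o') (o : Fin 3 → List Bool) :
    ∃ w, machine.runFrom A w (cfg (scan s) x o [] []) (5 * x.length) =
      cfg (scan s') [] (fun i => (o' i).reverse ++ o i) [] [] := by
  induction x generalizing s o' o with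
  | nil =>
    obtain ⟨rfl, rfl⟩ := h
    exact ⟨fun _ => false, rfl⟩
  | cons b x ih =>
    obtain ⟨c, o', h, rfl⟩ := h
    obtain ⟨w, e⟩ := ih h (fun i => (if s.echo b c i then [b] else []) ++ o i)
    -- A constant block of five choices will do, as only its entry at time `1` matters.
    refine ⟨fun t => if t < 5 then c else w (t - 5), ?_⟩
    rw [List.length_cons, mul_add, mul_one, add_comm, Machine.runFrom_add, runFrom_scan_cons]
    simp only [Nat.one_lt_ofNat, if_true, Nat.add_sub_cancel_left, Nat.not_lt.2 (Nat.le_add_right _ _),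
      if_false, e]
    congr 1
    funext i
    split <;> simp

/-- Each letter costs a pop and one push on each question; the last five steps detect the empty
stack and push `true`, then `false`, on both questions. -/
theorem runFrom_goal (w : ℕ → Bool) (a b g y z : List Bool) :
    machine.runFrom A w (cfg goal [] ![a, b, g] y z) (3 * g.length + 5) =
      cfg moveFirst [] ![a, b, []] (false :: true :: (g.reverse ++ y))
        (false :: true :: (g.reverse ++ z)) := by
  induction g generalizing w y z with
  | nil =>
    have h : ∀ d, machine.step A d (cfg goal [] ![a, b, []] y z) =
        cfg (separate true 0) [] ![a, b, []] y z := fun d => rfl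
    have h1 : ∀ d c y z, machine.step A d (cfg (separate c 0) [] ![a, b, []] y z) =
        cfg (separate c 1) [] ![a, b, []] (c :: y) z := fun d c => step_push_four rfl d _ _
    have h2 : ∀ d c y z, machine.step A d (cfg (separate c 1) [] ![a, b, []] y z) =
        cfg (if c then separate false 0 else moveFirst) [] ![a, b, []] y (c :: z) :=
      fun d c => step_push_five rfl d _ _
    simp [Machine.runFrom, h, h1, h2]
  | cons c g ih =>
    have h1 : ∀ d, machine.step A d (cfg goal [] ![a, b, c :: g] y z) =
        cfg (goalCopy c 0) [] ![a, b, g] y z := by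
      intro d
      rw [step_pop_out (f := fun b => goalCopy b 0) (i := 2) rfl d _ _ _ _ rfl]
      congr 1
      funext i; fin_cases i <;> rfl
    have h2 : ∀ d, machine.step A d (cfg (goalCopy c 0) [] ![a, b, g] y z) =
        cfg (goalCopy c 1) [] ![a, b, g] (c :: y) z := fun d => step_push_four rfl d _ _ _ _
    have h3 : ∀ d, machine.step A d (cfg (goalCopy c 1) [] ![a, b, g] (c :: y) z) =
        cfg goal [] ![a, b, g] (c :: y) (c :: z) := fun d => step_push_five rfl d _ _ _ _
    have h : machine.runFrom A w (cfg goal [] ![a, b, c :: g] y z) 3 =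
        cfg goal [] ![a, b, g] (c :: y) (c :: z) := by simp only [Machine.runFrom, h1, h2, h3]
    rw [List.length_cons, show 3 * (g.length + 1) + 5 = 3 + (3 * g.length + 5) by ring,
      Machine.runFrom_add, h, ih]
    simp

theorem runFrom_moveFirst (w : ℕ → Bool) (a b y z : List Bool) :
    machine.runFrom A w (cfg moveFirst [] ![a, b, []] y z) (2 * a.length + 1) =
      cfg moveSecond [] ![[], b, []] (a.reverse ++ y) z := by
  induction a generalizing w y with
  | nil => rfl
  | cons c a ih =>
    have h1 : ∀ d, machine.step A d (cfg moveFirst [] ![c :: a, b, []] y z) =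
        cfg (moveFirstPush c) [] ![a, b, []] y z := by
      intro d
      rw [step_pop_out (f := moveFirstPush) (i := 0) rfl d _ _ _ _ rfl]
      congr 1
      funext i; fin_cases i <;> rfl
    have h2 : ∀ d, machine.step A d (cfg (moveFirstPush c) [] ![a, b, []] y z) =
        cfg moveFirst [] ![a, b, []] (c :: y) z := fun d => step_push_four rfl d _ _ _ _
    have h : machine.runFrom A w (cfg moveFirst [] ![c :: a, b, []] y z) 2 =
        cfg moveFirst [] ![a, b, []] (c :: y) z := by simp only [Machine.runFrom, h1, h2]
    rw [List.length_cons, show 2 * (a.length + 1) + 1 = 2 + (2 * a.length + 1) by ring,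
      Machine.runFrom_add, h, ih]
    simp

theorem runFrom_moveSecond (w : ℕ → Bool) (b y z : List Bool) :
    machine.runFrom A w (cfg moveSecond [] ![[], b, []] y z) (2 * b.length + 1) =
      cfg askFirst [] ![[], [], []] y (b.reverse ++ z) := by
  induction b generalizing w z with
  | nil => rfl
  | cons c b ih =>
    have h1 : ∀ d, machine.step A d (cfg moveSecond [] ![[], c :: b, []] y z) =
        cfg (moveSecondPush c) [] ![[], b, []] y z := by
      intro d
      rw [step_pop_out (f := moveSecondPush) (i := 1) rfl d _ _ _ _ rfl]
      congr 1
      funext i; fin_cases i <;> rfl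
    have h2 : ∀ d, machine.step A d (cfg (moveSecondPush c) [] ![[], b, []] y z) =
        cfg moveSecond [] ![[], b, []] y (c :: z) := fun d => step_push_five rfl d _ _ _ _
    have h : machine.runFrom A w (cfg moveSecond [] ![[], c :: b, []] y z) 2 =
        cfg moveSecond [] ![[], b, []] y (c :: z) := by simp only [Machine.runFrom, h1, h2]
    rw [List.length_cons, show 2 * (b.length + 1) + 1 = 2 + (2 * b.length + 1) by ring,
      Machine.runFrom_add, h, ih]
    simp

/-- The question about an outcome whose formulas have the code `l` and a goal with the code `g`. -/
def question (l g : List Bool) : List Bool := l ++ false :: true :: (g ++ [false])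

open Classical in
theorem runFrom_ask (w : ℕ → Bool) (y z : List Bool) (o : Fin 3 → List Bool) :
    machine.runFrom A w (cfg askFirst [] o y z) 2 =
      cfg (if y ∈ A ∧ z ∉ A then acc else rej) [] o y z := by
  have h1 : ∀ d, machine.step A d (cfg askFirst [] o y z) =
      cfg (if y ∈ A then askSecond else rej) [] o y z := fun d =>
    Machine.step_query (M := machine) (q := askFirst) rfl d _
  have h2 : ∀ d, machine.step A d (cfg askSecond [] o y z) =
      cfg (if z ∈ A then rej else acc) [] o y z := fun d =>
    Machine.step_query (M := machine) (q := askSecond) rfl d _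
  have h3 : ∀ d, machine.step A d (cfg rej [] o y z) = cfg rej [] o y z := fun d =>
    Machine.step_of_halted (Or.inr rfl) d
  by_cases hy : y ∈ A <;> by_cases hz : z ∈ A <;> simp [Machine.runFrom, h1, h2, h3, hy, hz]

open Classical in
/-- What happens after the scanning phase. -/
theorem runFrom_scanned (w : ℕ → Bool) (s : Scan) (o : Fin 3 → List Bool) :
    ∃ n ≤ 2 * (o 0).length + 2 * (o 1).length + 3 * (o 2).length + 12,
      Machine.Halted machine
        (machine.runFrom A w (cfg (scan s) [] (fun i => (o i).reverse) [] []) n) ∧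
      (Machine.Accepting machine
        (machine.runFrom A w (cfg (scan s) [] (fun i => (o i).reverse) [] []) n) ↔
        s = done true ∧ question (o 0) (o 2) ∈ A ∧ question (o 1) (o 2) ∉ A) := by
  have h0 : ∀ d, machine.step A d (cfg (scan s) [] (fun i => (o i).reverse) [] []) =
      (cfg (if s = done true then close 0 else rej) [] (fun i => (o i).reverse) [] []) :=
    fun d => rfl
  by_cases hs : s = done true
  · have ho : (fun i => (o i).reverse) = ![(o 0).reverse, (o 1).reverse, (o 2).reverse] := by
      funext i; fin_cases i <;> rfl
    have h1 : ∀ d, machine.step A d (cfg (close 0) [] (fun i => (o i).reverse) [] []) =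
        (cfg (close 1) [] (fun i => (o i).reverse) [false] []) := fun d =>
      step_push_four rfl d _ _ _ _
    have h2 : ∀ d, machine.step A d (cfg (close 1) [] (fun i => (o i).reverse) [false] []) =
        (cfg goal [] (fun i => (o i).reverse) [false] [false]) := fun d =>
      step_push_five rfl d _ _ _ _
    have h3 : machine.runFrom A w (cfg (scan s) [] (fun i => (o i).reverse) [] []) 3 =
        (cfg goal [] (fun i => (o i).reverse) [false] [false]) := by
      simp only [Machine.runFrom, h0, if_pos hs, h1, h2]
    -- The summands are the times for closing both questions, copying the goal, moving each of the
    -- two outcomes, and asking.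
    refine ⟨3 + (3 * (o 2).reverse.length + 5 + (2 * (o 0).reverse.length + 1 +
      (2 * (o 1).reverse.length + 1 + 2))), ?_, ?_⟩
    · simp only [List.length_reverse]; omega
    rw [Machine.runFrom_add, h3, ho, Machine.runFrom_add, runFrom_goal, Machine.runFrom_add,
      runFrom_moveFirst, Machine.runFrom_add, runFrom_moveSecond, runFrom_ask]
    simp only [List.reverse_reverse, hs, true_and]
    by_cases h : question (o 0) (o 2) ∈ A ∧ question (o 1) (o 2) ∉ A
    · have h' := h
      unfold question at h'
      rw [if_pos h']
      exact ⟨Or.inl rfl, iff_of_true rfl h⟩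
    · have h' := h
      unfold question at h'
      rw [if_neg h']
      exact ⟨Or.inr rfl, iff_of_false (by intro e; cases e) h⟩
  · refine ⟨1, by omega, ?_⟩
    simp only [Machine.runFrom, h0, hs, if_false, false_and, iff_false]
    exact ⟨Or.inr rfl, by intro e; cases e⟩

/-- The words for which the machine finds a profitable deviation. -/
def language (A : Set (List Bool)) : Set (List Bool) :=
  {x | ∃ o, Trans (player false) x (done true) o ∧
    question (o 0) (o 2) ∈ A ∧ question (o 1) (o 2) ∉ A}

theorem init_eq (x : List Bool) :
    machine.init x = (cfg (scan (player false)) x (fun _ => []) [] []) := by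
  unfold Machine.init
  congr 1
  funext k
  rcases k with _ | _ | _ | _ | _ | _ | k <;> rfl

theorem decides (A : Set (List Bool)) : machine.DecidesInPolyTime A (language A) := by
  -- The scan takes five steps per letter. Since no output is longer than the input, the assembly
  -- takes at most `2 + 2 + 3` more per letter, plus `12`.
  refine ⟨12 * Polynomial.X + 12, fun x => ?_⟩
  have hev : (12 * Polynomial.X + 12 : Polynomial ℕ).eval x.length = 12 * x.length + 12 := by
    simp
  rw [hev]
  have key : ∀ (w : ℕ → Bool) (s : Scan) (o : Fin 3 → List Bool), Trans (player false) x s o →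
      machine.runFrom A w (cfg (scan (player false)) x (fun _ => []) [] []) (5 * x.length) =
        (cfg (scan s) [] (fun i => (o i).reverse ++ []) [] []) →
      machine.Halted (machine.run A w x (12 * x.length + 12)) ∧
      (machine.Accepting (machine.run A w x (12 * x.length + 12)) ↔
        s = done true ∧ question (o 0) (o 2) ∈ A ∧ question (o 1) (o 2) ∉ A) := by
    intro w s o h e
    simp only [List.append_nil] at e
    obtain ⟨n, hn, h1, h2⟩ := runFrom_scanned (A := A) (fun t => w (5 * x.length + t)) s o
    rw [← e, ← Machine.runFrom_add] at h1 h2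
    have := h.length_le 0
    have := h.length_le 1
    have := h.length_le 2
    rw [Machine.run_eq_runFrom, init_eq,
      Machine.runFrom_of_le (s := 5 * x.length + n) (by omega) h1]
    exact ⟨h1, h2⟩
  refine ⟨fun w => ?_, ?_, ?_⟩
  · obtain ⟨s, o, h, e⟩ := runFrom_scan (A := A) w (player false) x fun _ => []
    exact (key w s o h e).1
  · rintro ⟨o, h, hA⟩
    obtain ⟨w, e⟩ := Trans.exists_runFrom (A := A) h fun _ => []
    exact ⟨w, (key w _ o h e).2.2 ⟨rfl, hA⟩⟩
  · rintro ⟨w, hw⟩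
    obtain ⟨s, o, h, e⟩ := runFrom_scan (A := A) w (player false) x fun _ => []
    obtain ⟨rfl, hA⟩ := (key w s o h e).2.1 hw
    exact ⟨o, h, hA⟩

end Deviation

/-! ### From outputs of the transducer to deviations in the game -/

namespace Deviation

variable {LOG : SequentCalculus}

/-- The bits inserted after each argument of `question` are exactly the marks that the codes of the
two sides of the sequent contribute. -/
theorem question_items (l : List LOG.Formula) (γ : LOG.Formula) :
    question (items l) (LOG.encFormula γ) = LOG.encFormulas l ++ LOG.encFormulas [γ] := by
  rw [encFormulas_eq, encFormulas_eq, items_cons, items_nil, question]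
  simp

theorem coe_flatten {α : Type} (L : List (List α)) :
    ((L.flatten : List α) : Multiset α) = (L.map (Multiset.ofList (α := α))).sum := by
  induction L with
  | nil => rfl
  | cons l L ih => rw [List.flatten_cons, ← Multiset.coe_add, ih, List.map_cons, List.sum_cons]

theorem coe_flatten_ofFn {α : Type} {n : ℕ} (c : Fin n → List α) :
    (((List.ofFn c).flatten : List α) : Multiset α) = ∑ i, (c i : Multiset α) := by
  rw [coe_flatten, List.map_ofFn, List.sum_ofFn]
  rfl

theorem set_ofFn {α : Type} {n : ℕ} (c : Fin n → α) (i : Fin n) (a : α) :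
    (List.ofFn c).set i a = List.ofFn (Function.update c i a) := by
  apply List.ext_getElem
  · simp
  · intro j h1 h2
    rw [List.getElem_set, List.getElem_ofFn, List.getElem_ofFn]
    by_cases h : i = ⟨j, by simpa using h2⟩
    · rw [← h, if_pos (congrArg Fin.val h), Function.update_self]
    · rw [if_neg fun e => h (Fin.ext e), Function.update_of_ne (Ne.symm h)]

/-- If `V` answers the questions about sequents, then the machine finds a deviation iff the given
profile is no Nash equilibrium. -/
theorem mem_language_iff {V : Set (List Bool)}
    (hV : ∀ S : Sequent LOG.Formula, ∀ x ∈ LOG.sequentValidity.codes S,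
      (x ∈ V ↔ LOG.Provable S))
    (I : NEInstance LOG) (x : List Bool) (hx : x ∈ LOG.nashEquilibrium.codes I) :
    x ∈ language V ↔ ¬ I.game.IsNash I.profile := by
  obtain ⟨e, c, he, hc, rfl⟩ := hx
  have hq : ∀ (l : List LOG.Formula) (γ : LOG.Formula),
      question (items l) (LOG.encFormula γ) ∈ V ↔ LOG.Provable ⟨(l : Multiset LOG.Formula), {γ}⟩ :=
    fun l γ => hV ⟨l, {γ}⟩ _ ⟨l, [γ], rfl, rfl, question_items l γ⟩
  have hmap : (List.ofFn fun i => (I.game.goal i, e i, c i)).map (·.2.2) = List.ofFn c := by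
    rw [List.map_ofFn]; rfl
  have hout : ((List.ofFn c).flatten : Multiset LOG.Formula) = I.game.outcome I.profile := by
    rw [coe_flatten_ofFn, ResourceGame.outcome]
    simp only [hc]
  have hout' : ∀ (i : Fin I.game.n) (l' : List LOG.Formula),
      (((List.ofFn c).set i l').flatten : Multiset LOG.Formula) =
      I.game.outcome (Function.update I.profile i l') := by
    intro i l'
    rw [set_ofFn, coe_flatten_ofFn, ResourceGame.outcome]
    refine Finset.sum_congr rfl fun j _ => ?_
    by_cases h : j = i
    · subst h; simp
    · simp [h, hc]
  simp only [language, Set.mem_ofPred_eq, trans_players, hmap]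
  simp only [ResourceGame.IsNash, ResourceGame.StronglyPrefers, ResourceGame.Satisfies]
  push Not
  constructor
  · rintro ⟨_, ⟨i, hi, l', hl, rfl⟩, h1, h2⟩
    rw [List.length_ofFn] at hi
    simp only [List.getElem_ofFn] at hl h1 h2
    refine ⟨⟨i, hi⟩, l', ?_, ?_, ?_⟩
    · change (l' : Multiset LOG.Formula) ≤ _
      rw [← he ⟨i, hi⟩]
      exact hl.subperm
    · rw [← hout' ⟨i, hi⟩]
      exact (hq _ _).1 h1
    · rw [← hout]
      exact fun h => h2 ((hq _ _).2 h)
  · rintro ⟨i, C, hC, h1, h2⟩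
    change C ≤ _ at hC
    rw [← he] at hC
    obtain ⟨l, rfl⟩ := Quot.exists_rep C
    -- A submultiset is a sublist up to permutation. The permutation is harmless because `V` answers
    -- correctly on every code of a sequent.
    obtain ⟨l', hp, hl⟩ := Multiset.coe_le.1 hC
    have hl' : Quot.mk _ l = (l' : Multiset LOG.Formula) := (Multiset.coe_eq_coe.2 hp).symm
    rw [hl', ← hout'] at h1
    rw [← hout] at h2
    refine ⟨_, ⟨i, by simp, l', by simpa using hl, rfl⟩, ?_, ?_⟩
    · simp only [List.getElem_ofFn]
      exact (hq _ _).2 h1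
    · simp only [List.getElem_ofFn]
      exact fun h => h2 ((hq _ _).1 h)

/-- The problem NE belongs to `coNP` relative to any class in which sequent validity is. -/
theorem nashEquilibrium_inClass {C : Complexity.LangClass} (h : LOG.sequentValidity.InClass C) :
    LOG.nashEquilibrium.InClass (Complexity.co (Complexity.NPrel C)) := by
  obtain ⟨V, hC, hV⟩ := h
  refine ⟨(language V)ᶜ, ?_, fun I x hx => ?_⟩
  · change (language V)ᶜᶜ ∈ Complexity.NPrel C
    rw [compl_compl]
    exact ⟨V, hC, machine, decides V⟩
  · rw [Set.mem_compl_iff, mem_language_iff hV I x hx, not_not]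
    rfl

end Deviation

theorem DecisionProblem.InClass.mono {p : DecisionProblem} {C D : Complexity.LangClass}
    (h : p.InClass C) (hCD : C ⊆ D) : p.InClass D :=
  let ⟨L, hL, hp⟩ := h
  ⟨L, hCD hL, hp⟩

/-! ## Deterministic runs in bounded space -/

namespace Machine

variable {M : Machine}

/-- One step of a deterministic machine without queries. -/
noncomputable def next (M : Machine) (c : M.Cfg) : M.Cfg := M.step ∅ false c

theorem run_eq_iterate (hd : M.Deterministic) (w : ℕ → Bool) (x : List Bool) (t : ℕ) :
    M.run ∅ w x t = M.next^[t] (M.init x) := by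
  induction t with
  | zero => rfl
  | succ t ih =>
    rw [run, Function.iterate_succ_apply', ih, next]
    unfold step
    split
    all_goals first
      | rfl
      | exact absurd ‹_› (hd _ _ _)

theorem iterate_next_of_halted {c : M.Cfg} (h : M.Halted c) (n : ℕ) : M.next^[n] c = c :=
  Function.iterate_fixed (step_of_halted h _) n

/-- `c'` is reached from `c` in `n` steps. -/
def Steps (n : ℕ) (c c' : M.Cfg) : Prop := M.next^[n] c = c'

theorem Steps.trans {m n : ℕ} {c c' c'' : M.Cfg} (h : Steps m c c') (h' : Steps n c' c'') :
    Steps (m + n) c c'' := by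
  rw [Steps, add_comm, Function.iterate_add_apply, h, h']

theorem Steps.cast {m n : ℕ} {c c' : M.Cfg} (h : Steps m c c') (e : m = n) : Steps n c c' := e ▸ h

theorem Steps.one {c c' : M.Cfg} (h : M.next c = c') : Steps 1 c c' := h

/-- All stacks have length at most `B`. -/
def Within (B : ℕ) (c : M.Cfg) : Prop := ∀ k, (c.stk k).length ≤ B

/-- `c'` is reached from `c` and the stacks never get longer than `B` on the way. -/
def Reaches (B : ℕ) (c c' : M.Cfg) : Prop :=
  ∃ n, Steps n c c' ∧ ∀ m ≤ n, Within B (M.next^[m] c)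

theorem Reaches.refl {B : ℕ} {c : M.Cfg} (h : Within B c) : Reaches B c c :=
  ⟨0, rfl, fun m hm => by rwa [Nat.le_zero.1 hm]⟩

theorem Reaches.trans {B : ℕ} {c c' c'' : M.Cfg} (h : Reaches B c c') (h' : Reaches B c' c'') :
    Reaches B c c'' := by
  obtain ⟨n, hn, hb⟩ := h
  obtain ⟨n', hn', hb'⟩ := h'
  refine ⟨n + n', hn.trans hn', fun m hm => ?_⟩
  rcases le_total m n with h | h
  · exact hb m h
  · obtain ⟨d, rfl⟩ := Nat.exists_eq_add_of_le h
    rw [add_comm, Function.iterate_add_apply, show M.next^[n] c = c' from hn]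
    exact hb' d (by omega)

/-- A step lengthens a stack by at most one letter, so a run with a small time bound needs no
inspection on the way. Runs without such a bound go through `Reaches.head`. -/
theorem Steps.reaches {B N n : ℕ} {c c' : M.Cfg} (h : Steps n c c') (hc : Within N c)
    (hB : N + n ≤ B) : Reaches B c c' := by
  refine ⟨n, h, fun m hm => ?_⟩
  have : ∀ m, Within (N + m) (M.next^[m] c) := by
    intro m
    induction m with
    | zero => exact hc
    | succ m ih =>
      rw [Function.iterate_succ_apply']
      exact length_step_le _ _ ih
  exact fun k => (this m k).trans (by omega)

theorem Reaches.head {B : ℕ} {c c' c'' : M.Cfg} (hc : Within B c) (h : M.next c = c')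
    (h' : Reaches B c' c'') : Reaches B c c'' := by
  obtain ⟨n, hn, hb⟩ := h'
  subst h
  refine ⟨n + 1, hn, fun m hm => ?_⟩
  cases m with
  | zero => exact hc
  | succ m => exact hb m (by omega)

theorem DecidesInPolySpace.of_reaches (hd : M.Deterministic) {L : Set (List Bool)}
    (p : Polynomial ℕ)
    (h : ∀ x, ∃ c, Reaches (p.eval x.length) (M.init x) c ∧ M.Halted c ∧
      (x ∈ L ↔ M.Accepting c)) : M.DecidesInPolySpace L := by
  refine ⟨p, fun x => ?_⟩
  obtain ⟨c, ⟨n, hn, hb⟩, hc, hL⟩ := h x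
  have hn : M.next^[n] (M.init x) = c := hn
  have key : ∀ t, n ≤ t → M.next^[t] (M.init x) = c := by
    intro t ht
    obtain ⟨d, rfl⟩ := Nat.exists_eq_add_of_le ht
    rw [add_comm, Function.iterate_add_apply, hn, iterate_next_of_halted hc]
  simp only [run_eq_iterate hd]
  refine ⟨fun _ => ⟨n, hn ▸ hc⟩, fun _ t k => ?_, ?_⟩
  · rcases le_total t n with ht | ht
    · exact hb t ht k
    · rw [key t ht, ← hn]
      exact hb n le_rfl k
  · rw [hL]
    constructor
    · exact fun h => ⟨fun _ => false, n, hn ▸ h⟩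
    · rintro ⟨-, t, ht⟩
      have e := iterate_next_of_halted ht.halted n
      rw [← Function.iterate_add_apply, add_comm, add_comm, key _ (by omega)] at e
      rwa [e]

/-- The first halting time is taken, because a simulation follows the machine step by step only
until it halts. -/
theorem DecidesInPolySpace.exists_halted (hd : M.Deterministic) {L : Set (List Bool)}
    {p : Polynomial ℕ} {x : List Bool}
    (h : (∀ w, ∃ t, M.Halted (M.run ∅ w x t)) ∧
      (∀ w t k, ((M.run ∅ w x t).stk k).length ≤ p.eval x.length) ∧
      (x ∈ L ↔ ∃ w t, M.Accepting (M.run ∅ w x t))) :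
    ∃ n, (∀ m < n, ¬ M.Halted (M.next^[m] (M.init x))) ∧
      (∀ m, Within (p.eval x.length) (M.next^[m] (M.init x))) ∧
      M.Halted (M.next^[n] (M.init x)) ∧ (x ∈ L ↔ M.Accepting (M.next^[n] (M.init x))) := by
  classical
  simp only [run_eq_iterate hd] at h
  obtain ⟨h1, h2, h3⟩ := h
  have hex := h1 fun _ => false
  refine ⟨Nat.find hex, fun m hm => Nat.find_min hex hm, h2 fun _ => false, Nat.find_spec hex, ?_⟩
  rw [h3]
  constructor
  · rintro ⟨-, t, ht⟩
    obtain ⟨d, rfl⟩ := Nat.exists_eq_add_of_le (Nat.find_min' hex ht.halted)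
    rwa [add_comm, Function.iterate_add_apply, iterate_next_of_halted (Nat.find_spec hex)] at ht
  · exact fun ht => ⟨fun _ => false, _, ht⟩

end Machine

/-! ## Backtracking in polynomial space -/

namespace Backtrack

/-- The states of the backtracking machine; `Q` and `R` are the types of states of the simulated
machine and of the machine for the oracle, which use stacks up to `K` and `J`. -/
inductive State (Q R : Type) (K J : ℕ) : Type
  | load
  | loadPush (b : Bool)
  | reload
  | reloadPush (b : Bool)
  | distribute
  | distInput (b : Bool)
  | distSave (b : Bool)
  | sim (q : Q)
  | mark (q : Q) (b : Bool)
  | exec (q : Q)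
  | ask (q : Q) (b : Bool)
  | askBack (q : Q)
  | askRestore (q : Q) (b : Bool)
  | askCopy (q : Q) (b : Bool)
  | oracle (q : Q) (r : R)
  | oracleWipe (q : Q) (ans : Bool) (j : Fin (J + 1))
  | wipe (j : Fin (K + 1))
  | back
  | turn
  | rewind
  | rewindPush (b : Bool)
  | acc

namespace State

variable {Q R : Type} {K J : ℕ}

/-- The components of a state, the first being the number of the constructor. -/
def toProd : State Q R K J → Fin 22 × Option Q × Option R × Bool × Fin (K + 1) × Fin (J + 1)
  | load => (0, none, none, false, 0, 0)
  | loadPush b => (1, none, none, b, 0, 0)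
  | reload => (2, none, none, false, 0, 0)
  | reloadPush b => (3, none, none, b, 0, 0)
  | distribute => (4, none, none, false, 0, 0)
  | distInput b => (5, none, none, b, 0, 0)
  | distSave b => (6, none, none, b, 0, 0)
  | sim q => (7, some q, none, false, 0, 0)
  | mark q b => (8, some q, none, b, 0, 0)
  | exec q => (9, some q, none, false, 0, 0)
  | ask q b => (10, some q, none, b, 0, 0)
  | askBack q => (11, some q, none, false, 0, 0)
  | askRestore q b => (12, some q, none, b, 0, 0)
  | askCopy q b => (13, some q, none, b, 0, 0)
  | oracle q r => (14, some q, some r, false, 0, 0)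
  | oracleWipe q ans j => (15, some q, none, ans, 0, j)
  | wipe j => (16, none, none, false, j, 0)
  | back => (17, none, none, false, 0, 0)
  | turn => (18, none, none, false, 0, 0)
  | rewind => (19, none, none, false, 0, 0)
  | rewindPush b => (20, none, none, b, 0, 0)
  | acc => (21, none, none, false, 0, 0)

theorem toProd_injective : Function.Injective (toProd (Q := Q) (R := R) (K := K) (J := J)) := by
  intro s t h
  cases s <;> cases t <;> simp [toProd] at h ⊢ <;> exact h

instance [Finite Q] [Finite R] : Finite (State Q R K J) :=
  Finite.of_injective _ toProd_injective

end State

open State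

variable (M V : Machine) (K J : ℕ)

/-- The state after the answer `ans` to the query of the state `q`. -/
def answer (q : M.Q) (ans : Bool) : M.Q :=
  match M.prog q with
  | .query _ qn qy => bif ans then qy else qn
  | _ => q

/-- The state after a guess. -/
def afterMark (q : M.Q) (b : Bool) : State M.Q V.Q K J :=
  match M.prog q with
  | .guess q0 q1 => sim (if b then q1 else q0)
  | _ => exec q

/-- The machine that searches the computation tree of `M` for an accepting path and rejects if it
has found one, the queries being answered by `V`.

The stack `k` of `M` is kept on the stack `3 * k` and that of `V` on the stack `3 * k + 1`. The
stack `2` holds the choices prescribed for the rest of the current path, the stack `5` the choices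
made so far, the stack `8` the input, and the stack `11` is for copying. -/
def machine : Machine where
  Q := State M.Q V.Q K J
  finite_states := by
    have := M.finite_states
    have := V.finite_states
    infer_instance
  start := load
  prog
    | load => .pop 0 distribute (loadPush false) (loadPush true)
    | loadPush b => .push 11 b load
    | reload => .pop 8 distribute (reloadPush false) (reloadPush true)
    | reloadPush b => .push 11 b reload
    | distribute => .pop 11 (sim M.start) (distInput false) (distInput true)
    | distInput b => .push 0 b (distSave b)
    | distSave b => .push 8 b distribute
    | sim q =>
        match M.prog q with
        | .accept => .reject
        -- This pop merely changes the state: a letter it removes would be erased next anyway.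
        | .reject => .pop 0 (wipe (Fin.last K)) (wipe (Fin.last K)) (wipe (Fin.last K))
        -- Every step of `M`, not only a guess, uses up one choice, so that the record of choices is
        -- a path in the sense of `Machine.path`. The default choice is `false`.
        | _ => .pop 2 (mark q false) (mark q false) (mark q true)
    | mark q b => .push 5 b (afterMark M V K J q b)
    | exec q =>
        match M.prog q with
        | .push k b q' => .push (3 * k) b (sim q')
        | .pop k qe q0 q1 => .pop (3 * k) (sim qe) (sim q0) (sim q1)
        | .query k _ _ => .pop (3 * k) (askBack q) (ask q false) (ask q true)
        | _ => .reject
    | ask q b => .push 11 b (exec q)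
    | askBack q => .pop 11 (oracle q V.start) (askRestore q false) (askRestore q true)
    | askRestore q b =>
        match M.prog q with
        | .query k _ _ => .push (3 * k) b (askCopy q b)
        | _ => .reject
    | askCopy q b => .push 1 b (askBack q)
    | oracle q r =>
        match V.prog r with
        | .push k b r' => .push (3 * k + 1) b (oracle q r')
        | .pop k re r0 r1 => .pop (3 * k + 1) (oracle q re) (oracle q r0) (oracle q r1)
        | .accept => .pop 1 (oracleWipe q true (Fin.last J)) (oracleWipe q true (Fin.last J))
            (oracleWipe q true (Fin.last J))
        | .reject => .pop 1 (oracleWipe q false (Fin.last J)) (oracleWipe q false (Fin.last J))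
            (oracleWipe q false (Fin.last J))
        | _ => .reject
    | oracleWipe q ans j => .pop (3 * j + 1)
        (if j.1 = 0 then sim (answer M q ans) else oracleWipe q ans ⟨j.1 - 1, by omega⟩)
        (oracleWipe q ans j) (oracleWipe q ans j)
    | wipe j => .pop (3 * j) (if j.1 = 0 then back else wipe ⟨j.1 - 1, by omega⟩)
        (wipe j) (wipe j)
    -- Trailing choices `true` are exhausted and dropped; the last `false` is turned into `true`.
    -- This yields the next branch in lexicographic order.
    | back => .pop 5 acc turn back
    | turn => .push 2 true rewind
    | rewind => .pop 5 reload (rewindPush false) (rewindPush true)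
    | rewindPush b => .push 2 b rewind
    | acc => .accept

theorem machine_queryFree : (machine M V K J).QueryFree := by
  intro q k qn qy h
  cases q <;> simp only [machine] at h <;> first | cases h | (split at h <;> cases h)

theorem machine_deterministic : (machine M V K J).Deterministic := by
  intro q q0 q1 h
  cases q <;> simp only [machine] at h <;> first | cases h | (split at h <;> cases h)

end Backtrack

/-! ### Stack layout of the backtracking machine -/

namespace Backtrack

open State Machine

/-- The stacks of the backtracking machine that do not belong to the simulated machines. -/
def aux (g u s t : List Bool) : ℕ → List Bool
  | 0 => g
  | 1 => u
  | 2 => s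
  | 3 => t
  | _ => []

/-- The contents of the stacks of the backtracking machine: those of the two simulated machines, the
prescribed choices, the choices made so far, the input, and the stack for copying. -/
def store (m v : ℕ → List Bool) (g u s t : List Bool) (i : ℕ) : List Bool :=
  match i % 3 with
  | 0 => m (i / 3)
  | 1 => v (i / 3)
  | _ => aux g u s t (i / 3)

section store

variable (m v : ℕ → List Bool) (g u s t l : List Bool) (k : ℕ)

theorem store_sim : store m v g u s t (3 * k) = m k := by
  simp [store]

theorem store_oracle : store m v g u s t (3 * k + 1) = v k := by
  have h1 : (3 * k + 1) % 3 = 1 := by omega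
  have h2 : (3 * k + 1) / 3 = k := by omega
  simp [store, h1, h2]

theorem store_aux : store m v g u s t (3 * k + 2) = aux g u s t k := by
  have h1 : (3 * k + 2) % 3 = 2 := by omega
  have h2 : (3 * k + 2) / 3 = k := by omega
  simp [store, h1, h2]

theorem store_ext {f f' : ℕ → List Bool} (h0 : ∀ k, f (3 * k) = f' (3 * k))
    (h1 : ∀ k, f (3 * k + 1) = f' (3 * k + 1)) (h2 : ∀ k, f (3 * k + 2) = f' (3 * k + 2)) :
    f = f' := by
  funext i
  rcases (by omega : i = 3 * (i / 3) ∨ i = 3 * (i / 3) + 1 ∨ i = 3 * (i / 3) + 2) with e | e | e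
  · rw [e]; exact h0 _
  · rw [e]; exact h1 _
  · rw [e]; exact h2 _

theorem update_store_sim :
    Function.update (store m v g u s t) (3 * k) l = store (Function.update m k l) v g u s t := by
  apply store_ext <;> intro j
  · by_cases h : j = k
    · subst h; simp only [Function.update_self, store_sim]
    · rw [Function.update_of_ne (by omega), store_sim, store_sim, Function.update_of_ne h]
  · rw [Function.update_of_ne (by omega), store_oracle, store_oracle]
  · rw [Function.update_of_ne (by omega), store_aux, store_aux]

theorem update_store_oracle :
    Function.update (store m v g u s t) (3 * k + 1) l =
      store m (Function.update v k l) g u s t := by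
  apply store_ext <;> intro j
  · rw [Function.update_of_ne (by omega), store_sim, store_sim]
  · by_cases h : j = k
    · subst h; simp only [Function.update_self, store_oracle]
    · rw [Function.update_of_ne (by omega), store_oracle, store_oracle, Function.update_of_ne h]
  · rw [Function.update_of_ne (by omega), store_aux, store_aux]

theorem update_store_aux {g' u' s' t' : List Bool}
    (h : Function.update (aux g u s t) k l = aux g' u' s' t') :
    Function.update (store m v g u s t) (3 * k + 2) l = store m v g' u' s' t' := by
  apply store_ext <;> intro j
  · rw [Function.update_of_ne (by omega), store_sim, store_sim]
  · rw [Function.update_of_ne (by omega), store_oracle, store_oracle]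
  · rw [store_aux, ← h]
    by_cases hj : j = k
    · subst hj; simp only [Function.update_self]
    · rw [Function.update_of_ne (by omega), store_aux, Function.update_of_ne hj]

theorem update_store_guide :
    Function.update (store m v g u s t) 2 l = store m v l u s t :=
  update_store_aux m v g u s t l 0 (by funext j; rcases j with _ | _ | _ | _ | j <;> rfl)

theorem update_store_used :
    Function.update (store m v g u s t) 5 l = store m v g l s t :=
  update_store_aux m v g u s t l 1 (by funext j; rcases j with _ | _ | _ | _ | j <;> rfl)

theorem update_store_input :
    Function.update (store m v g u s t) 8 l = store m v g u l t :=
  update_store_aux m v g u s t l 2 (by funext j; rcases j with _ | _ | _ | _ | j <;> rfl)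

theorem update_store_copy :
    Function.update (store m v g u s t) 11 l = store m v g u s l :=
  update_store_aux m v g u s t l 3 (by funext j; rcases j with _ | _ | _ | _ | j <;> rfl)

end store

variable {M V : Machine} {K J : ℕ}

/-- A configuration of the backtracking machine. -/
def cfg (q : State M.Q V.Q K J) (m v : ℕ → List Bool) (g u s t : List Bool) :
    (machine M V K J).Cfg :=
  ⟨q, store m v g u s t⟩

/-- Stacks of which only the first may be nonempty. -/
def single (x : List Bool) : ℕ → List Bool := Function.update (fun _ => []) 0 x

theorem single_zero (x : List Bool) : single x 0 = x := Function.update_self ..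

theorem single_nil : single [] = fun _ => [] := Function.update_eq_self 0 _

theorem update_single (x y : List Bool) : Function.update (single x) 0 y = single y :=
  Function.update_idem ..

theorem length_single_le (x : List Bool) (k : ℕ) : (single x k).length ≤ x.length := by
  by_cases h : k = 0
  · subst h; rw [single_zero]
  · simp [single, h]

theorem within_cfg {q : State M.Q V.Q K J} {m v : ℕ → List Bool} {g u s t : List Bool} {N : ℕ}
    (hm : ∀ k, (m k).length ≤ N) (hv : ∀ k, (v k).length ≤ N) (hg : g.length ≤ N)
    (hu : u.length ≤ N) (hs : s.length ≤ N) (ht : t.length ≤ N) : Within N (cfg q m v g u s t) := by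
  intro i
  change (store m v g u s t i).length ≤ N
  unfold store
  split
  · exact hm _
  · exact hv _
  · unfold aux
    split <;> simp_all

section steps

variable {q q' qe : State M.Q V.Q K J} {f : Bool → State M.Q V.Q K J} {b : Bool} {l : List Bool}
  {k : ℕ} (m v : ℕ → List Bool) (g u s t : List Bool)

local notation "𝔅" => machine M V K J

theorem next_push {i : ℕ} (h : Machine.prog 𝔅 q = .push i b q') (st : ℕ → List Bool) :
    Machine.next 𝔅 ⟨q, st⟩ = ⟨q', Function.update st i (b :: st i)⟩ := step_push h _ _

theorem next_pop_nil {i : ℕ} {q0 q1 : State M.Q V.Q K J}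
    (h : Machine.prog 𝔅 q = .pop i qe q0 q1) {st : ℕ → List Bool}
    (hi : st i = []) : Machine.next 𝔅 ⟨q, st⟩ = ⟨qe, st⟩ := step_pop_nil h _ hi

theorem next_pop_cons {i : ℕ} (h : Machine.prog 𝔅 q = .pop i qe (f false) (f true))
    {st : ℕ → List Bool} (hi : st i = b :: l) :
    Machine.next 𝔅 ⟨q, st⟩ = ⟨f b, Function.update st i l⟩ := by
  rw [next, step_pop_cons h _ hi]
  cases b <;> rfl

theorem next_push_sim (h : Machine.prog 𝔅 q = .push (3 * k) b q') :
    Machine.next 𝔅 (cfg q m v g u s t) = cfg q' (Function.update m k (b :: m k)) v g u s t := by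
  rw [cfg, next_push h, store_sim, update_store_sim]; rfl

theorem next_push_oracle (h : Machine.prog 𝔅 q = .push (3 * k + 1) b q') :
    Machine.next 𝔅 (cfg q m v g u s t) = cfg q' m (Function.update v k (b :: v k)) g u s t := by
  rw [cfg, next_push h, store_oracle, update_store_oracle]; rfl

theorem next_push_guide (h : Machine.prog 𝔅 q = .push 2 b q') :
    Machine.next 𝔅 (cfg q m v g u s t) = cfg q' m v (b :: g) u s t := by
  rw [cfg, next_push h, update_store_guide]; rfl

theorem next_push_used (h : Machine.prog 𝔅 q = .push 5 b q') :
    Machine.next 𝔅 (cfg q m v g u s t) = cfg q' m v g (b :: u) s t := by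
  rw [cfg, next_push h, update_store_used]; rfl

theorem next_push_input (h : Machine.prog 𝔅 q = .push 8 b q') :
    Machine.next 𝔅 (cfg q m v g u s t) = cfg q' m v g u (b :: s) t := by
  rw [cfg, next_push h, update_store_input]; rfl

theorem next_push_copy (h : Machine.prog 𝔅 q = .push 11 b q') :
    Machine.next 𝔅 (cfg q m v g u s t) = cfg q' m v g u s (b :: t) := by
  rw [cfg, next_push h, update_store_copy]; rfl

theorem next_pop_sim (h : Machine.prog 𝔅 q = .pop (3 * k) qe (f false) (f true))
    (hk : m k = b :: l) :
    Machine.next 𝔅 (cfg q m v g u s t) = cfg (f b) (Function.update m k l) v g u s t := by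
  rw [cfg, next_pop_cons h ((store_sim ..).trans hk), update_store_sim]; rfl

theorem next_pop_oracle (h : Machine.prog 𝔅 q = .pop (3 * k + 1) qe (f false) (f true))
    (hk : v k = b :: l) :
    Machine.next 𝔅 (cfg q m v g u s t) = cfg (f b) m (Function.update v k l) g u s t := by
  rw [cfg, next_pop_cons h ((store_oracle ..).trans hk), update_store_oracle]; rfl

theorem next_pop_guide (h : Machine.prog 𝔅 q = .pop 2 qe (f false) (f true)) :
    Machine.next 𝔅 (cfg q m v (b :: g) u s t) = cfg (f b) m v g u s t := by
  rw [cfg, next_pop_cons h (b := b) (l := g) rfl, update_store_guide]; rfl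

theorem next_pop_used (h : Machine.prog 𝔅 q = .pop 5 qe (f false) (f true)) :
    Machine.next 𝔅 (cfg q m v g (b :: u) s t) = cfg (f b) m v g u s t := by
  rw [cfg, next_pop_cons h (b := b) (l := u) rfl, update_store_used]; rfl

theorem next_pop_input (h : Machine.prog 𝔅 q = .pop 8 qe (f false) (f true)) :
    Machine.next 𝔅 (cfg q m v g u (b :: s) t) = cfg (f b) m v g u s t := by
  rw [cfg, next_pop_cons h (b := b) (l := s) rfl, update_store_input]; rfl

theorem next_pop_copy (h : Machine.prog 𝔅 q = .pop 11 qe (f false) (f true)) :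
    Machine.next 𝔅 (cfg q m v g u s (b :: t)) = cfg (f b) m v g u s t := by
  rw [cfg, next_pop_cons h (b := b) (l := t) rfl, update_store_copy]; rfl

theorem next_pop_sim_nil {q0 q1} (h : Machine.prog 𝔅 q = .pop (3 * k) qe q0 q1)
    (hk : m k = []) : Machine.next 𝔅 (cfg q m v g u s t) = cfg qe m v g u s t :=
  next_pop_nil h ((store_sim ..).trans hk)

theorem next_pop_oracle_nil {q0 q1} (h : Machine.prog 𝔅 q = .pop (3 * k + 1) qe q0 q1)
    (hk : v k = []) : Machine.next 𝔅 (cfg q m v g u s t) = cfg qe m v g u s t :=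
  next_pop_nil h ((store_oracle ..).trans hk)

end steps

/-! ### Loops that copy and erase stacks -/

section loops

local notation "𝔅" => machine M V K J

theorem steps_load (v : ℕ → List Bool) (x g u s t : List Bool) :
    Steps (M := 𝔅) (2 * x.length + 1) (cfg load (single x) v g u s t)
      (cfg distribute (single []) v g u s (x.reverse ++ t)) := by
  induction x generalizing t with
  | nil => exact Steps.one (next_pop_sim_nil (k := 0) _ _ _ _ _ _ rfl rfl)
  | cons b x ih =>
    have h1 := next_pop_sim (M := M) (V := V) (K := K) (J := J) (q := load) (f := loadPush) (k := 0)
      (single (b :: x)) v g u s t rfl (single_zero _)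
    rw [update_single] at h1
    have h2 := next_push_copy (M := M) (V := V) (K := K) (J := J) (q := loadPush b)
      (single x) v g u s t rfl
    have := ((Steps.one h1).trans (Steps.one h2)).trans (ih (b :: t))
    simpa using this.cast
      (show _ = 2 * (b :: x).length + 1 by simp only [List.length_cons]; ring)

theorem steps_reload (m v : ℕ → List Bool) (g u s t : List Bool) :
    Steps (M := 𝔅) (2 * s.length + 1) (cfg reload m v g u s t)
      (cfg distribute m v g u [] (s.reverse ++ t)) := by
  induction s generalizing t with
  | nil => exact Steps.one (next_pop_nil rfl rfl)
  | cons b s ih =>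
    have h1 := next_pop_input (M := M) (V := V) (K := K) (J := J) (q := reload) (f := reloadPush)
      (b := b) m v g u s t rfl
    have h2 := next_push_copy (M := M) (V := V) (K := K) (J := J) (q := reloadPush b)
      m v g u s t rfl
    have := ((Steps.one h1).trans (Steps.one h2)).trans (ih (b :: t))
    simpa using this.cast
      (show _ = 2 * (b :: s).length + 1 by simp only [List.length_cons]; ring)

theorem steps_distribute (v : ℕ → List Bool) (x g u s t : List Bool) :
    Steps (M := 𝔅) (3 * t.length + 1) (cfg distribute (single x) v g u s t)
      (cfg (sim M.start) (single (t.reverse ++ x)) v g u (t.reverse ++ s) []) := by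
  induction t generalizing x s with
  | nil => exact Steps.one (next_pop_nil rfl rfl)
  | cons b t ih =>
    have h1 := next_pop_copy (M := M) (V := V) (K := K) (J := J) (q := distribute)
      (f := distInput) (b := b) (single x) v g u s t rfl
    have h2 := next_push_sim (M := M) (V := V) (K := K) (J := J) (q := distInput b) (k := 0)
      (single x) v g u s t rfl
    rw [update_single, single_zero] at h2
    have h3 := next_push_input (M := M) (V := V) (K := K) (J := J) (q := distSave b)
      (single (b :: x)) v g u s t rfl
    have := (((Steps.one h1).trans (Steps.one h2)).trans (Steps.one h3)).trans
      (ih (b :: x) (b :: s))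
    simpa using this.cast
      (show _ = 3 * (b :: t).length + 1 by simp only [List.length_cons]; ring)

theorem steps_rewind (m v : ℕ → List Bool) (g u s t : List Bool) :
    Steps (M := 𝔅) (2 * u.length + 1) (cfg rewind m v g u s t)
      (cfg reload m v (u.reverse ++ g) [] s t) := by
  induction u generalizing g with
  | nil => exact Steps.one (next_pop_nil rfl rfl)
  | cons b u ih =>
    have h1 := next_pop_used (M := M) (V := V) (K := K) (J := J) (q := rewind) (f := rewindPush)
      (b := b) m v g u s t rfl
    have h2 := next_push_guide (M := M) (V := V) (K := K) (J := J) (q := rewindPush b)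
      m v g u s t rfl
    have := ((Steps.one h1).trans (Steps.one h2)).trans (ih (b :: g))
    simpa using this.cast
      (show _ = 2 * (b :: u).length + 1 by simp only [List.length_cons]; ring)

theorem prog_exec_query {q qn qy : M.Q} {k : ℕ} (hq : M.prog q = .query k qn qy) :
    Machine.prog 𝔅 (exec q) = .pop (3 * k) (askBack q) (ask q false) (ask q true) := by
  simp only [machine, hq]

theorem prog_askRestore {q qn qy : M.Q} {k : ℕ} (hq : M.prog q = .query k qn qy) (b : Bool) :
    Machine.prog 𝔅 (askRestore q b) = .push (3 * k) b (askCopy q b) := by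
  simp only [machine, hq]

/-- A query must not consume its word. The word is first moved to the copying stack; `steps_askBack`
then returns it to `M` and duplicates it on the input stack of `V`. -/
theorem steps_ask {q qn qy : M.Q} {k : ℕ} (hq : M.prog q = .query k qn qy)
    (m v : ℕ → List Bool) (l g u s t : List Bool) :
    Steps (M := 𝔅) (2 * l.length + 1) (cfg (exec q) (Function.update m k l) v g u s t)
      (cfg (askBack q) (Function.update m k []) v g u s (l.reverse ++ t)) := by
  induction l generalizing t with
  | nil =>
    exact Steps.one (next_pop_sim_nil _ _ _ _ _ _ (prog_exec_query hq) (Function.update_self ..))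
  | cons b l ih =>
    have h1 := next_pop_sim (M := M) (V := V) (K := K) (J := J) (f := ask q)
      (Function.update m k (b :: l)) v g u s t (prog_exec_query hq) (Function.update_self ..)
    rw [Function.update_idem] at h1
    have h2 := next_push_copy (M := M) (V := V) (K := K) (J := J) (q := ask q b)
      (Function.update m k l) v g u s t rfl
    have := ((Steps.one h1).trans (Steps.one h2)).trans (ih (b :: t))
    simpa using this.cast
      (show _ = 2 * (b :: l).length + 1 by simp only [List.length_cons]; ring)

theorem steps_askBack {q qn qy : M.Q} {k : ℕ} (hq : M.prog q = .query k qn qy)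
    (m : ℕ → List Bool) (y x g u s t : List Bool) :
    Steps (M := 𝔅) (3 * t.length + 1) (cfg (askBack q) (Function.update m k y) (single x) g u s t)
      (cfg (oracle q V.start) (Function.update m k (t.reverse ++ y)) (single (t.reverse ++ x))
        g u s []) := by
  induction t generalizing x y with
  | nil => exact Steps.one (next_pop_nil rfl rfl)
  | cons b t ih =>
    have h1 := next_pop_copy (M := M) (V := V) (K := K) (J := J) (q := askBack q)
      (f := askRestore q) (b := b) (Function.update m k y) (single x) g u s t rfl
    have h2 := next_push_sim (M := M) (V := V) (K := K) (J := J)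
      (Function.update m k y) (single x) g u s t (prog_askRestore hq b)
    rw [Function.update_idem, Function.update_self] at h2
    have h3 := next_push_oracle (M := M) (V := V) (K := K) (J := J) (q := askCopy q b) (k := 0)
      (Function.update m k (b :: y)) (single x) g u s t rfl
    rw [update_single, single_zero] at h3
    have := (((Steps.one h1).trans (Steps.one h2)).trans (Steps.one h3)).trans
      (ih (b :: y) (b :: x))
    simpa using this.cast
      (show _ = 3 * (b :: t).length + 1 by simp only [List.length_cons]; ring)

/-- Pops never lengthen a stack, so the bound persists however many letters are erased. The outer
induction runs down the stack indices, the inner one along the content of the current stack. -/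
theorem reaches_wipe {B : ℕ} {g u s t : List Bool} (hg : g.length ≤ B) (hu : u.length ≤ B)
    (hs : s.length ≤ B) (ht : t.length ≤ B) (j : Fin (K + 1)) (m : ℕ → List Bool)
    (hm : ∀ k, (m k).length ≤ B) (hj : ∀ k, j.1 < k → m k = []) :
    Reaches (M := 𝔅) B (cfg (wipe j) m (fun _ => []) g u s t)
      (cfg back (fun _ => []) (fun _ => []) g u s t) := by
  have hw : ∀ {q m}, (∀ k, (m k).length ≤ B) →
      Within B (cfg (M := M) (V := V) (K := K) (J := J) q m (fun _ => []) g u s t) := fun hm =>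
    within_cfg hm (by simp) hg hu hs ht
  obtain ⟨j, hjK⟩ := j
  induction j generalizing m with
  | zero =>
    generalize hl : m 0 = l
    induction l generalizing m with
    | nil =>
      have : m = fun _ => [] := funext fun k => by
        rcases Nat.eq_zero_or_pos k with rfl | h
        exacts [hl, hj k h]
      subst this
      exact .head (hw hm) (next_pop_sim_nil (k := 0) _ _ _ _ _ _ rfl rfl) (.refl (hw hm))
    | cons b l ih =>
      refine .head (hw hm) (next_pop_sim (f := fun _ => wipe ⟨0, hjK⟩) (k := 0) _ _ _ _ _ _ rfl hl)
        (ih _ (fun k => ?_) (fun k hk => ?_) (Function.update_self ..))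
      · have := hm 0
        rw [hl, List.length_cons] at this
        by_cases h : k = 0
        · subst h; rw [Function.update_self]; omega
        · rw [Function.update_of_ne h]; exact hm k
      · rw [Function.update_of_ne (by simp at hk; omega)]; exact hj k hk
  | succ j ihj =>
    generalize hl : m (j + 1) = l
    induction l generalizing m with
    | nil =>
      refine .head (hw hm) (next_pop_sim_nil (k := j + 1) _ _ _ _ _ _ rfl hl)
        (ihj m hm (by omega) fun k hk => ?_)
      rcases (by simp at hk; omega : k = j + 1 ∨ j + 1 < k) with rfl | h
      exacts [hl, hj k h]
    | cons b l ih =>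
      refine .head (hw hm) (next_pop_sim (f := fun _ => wipe ⟨j + 1, hjK⟩) (k := j + 1)
        _ _ _ _ _ _ rfl hl) (ih _ (fun k => ?_) (fun k hk => ?_) (Function.update_self ..))
      · have := hm (j + 1)
        rw [hl, List.length_cons] at this
        by_cases h : k = j + 1
        · subst h; rw [Function.update_self]; omega
        · rw [Function.update_of_ne h]; exact hm k
      · rw [Function.update_of_ne (by simp at hk; omega)]; exact hj k hk

theorem reaches_oracleWipe {B : ℕ} {m : ℕ → List Bool} {g u s t : List Bool}
    (hm : ∀ k, (m k).length ≤ B) (hg : g.length ≤ B) (hu : u.length ≤ B)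
    (hs : s.length ≤ B) (ht : t.length ≤ B) (q : M.Q) (ans : Bool) (j : Fin (J + 1))
    (v : ℕ → List Bool) (hv : ∀ k, (v k).length ≤ B) (hj : ∀ k, j.1 < k → v k = []) :
    Reaches (M := 𝔅) B (cfg (oracleWipe q ans j) m v g u s t)
      (cfg (sim (answer M q ans)) m (fun _ => []) g u s t) := by
  have hw : ∀ {q v}, (∀ k, (v k).length ≤ B) →
      Within B (cfg (M := M) (V := V) (K := K) (J := J) q m v g u s t) := fun hv =>
    within_cfg hm hv hg hu hs ht
  obtain ⟨j, hjJ⟩ := j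
  induction j generalizing v with
  | zero =>
    generalize hl : v 0 = l
    induction l generalizing v with
    | nil =>
      have : v = fun _ => [] := funext fun k => by
        rcases Nat.eq_zero_or_pos k with rfl | h
        exacts [hl, hj k h]
      subst this
      exact .head (hw hv) (next_pop_oracle_nil (k := 0) _ _ _ _ _ _ rfl rfl) (.refl (hw hv))
    | cons b l ih =>
      refine .head (hw hv) (next_pop_oracle (f := fun _ => oracleWipe q ans ⟨0, hjJ⟩) (k := 0)
        _ _ _ _ _ _ rfl hl) (ih _ (fun k => ?_) (fun k hk => ?_) (Function.update_self ..))
      · have := hv 0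
        rw [hl, List.length_cons] at this
        by_cases h : k = 0
        · subst h; rw [Function.update_self]; omega
        · rw [Function.update_of_ne h]; exact hv k
      · rw [Function.update_of_ne (by simp at hk; omega)]; exact hj k hk
  | succ j ihj =>
    generalize hl : v (j + 1) = l
    induction l generalizing v with
    | nil =>
      refine .head (hw hv) (next_pop_oracle_nil (k := j + 1) _ _ _ _ _ _ rfl hl)
        (ihj v hv (by omega) fun k hk => ?_)
      rcases (by simp at hk; omega : k = j + 1 ∨ j + 1 < k) with rfl | h
      exacts [hl, hj k h]
    | cons b l ih =>
      refine .head (hw hv) (next_pop_oracle (f := fun _ => oracleWipe q ans ⟨j + 1, hjJ⟩)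
        (k := j + 1) _ _ _ _ _ _ rfl hl)
        (ih _ (fun k => ?_) (fun k hk => ?_) (Function.update_self ..))
      · have := hv (j + 1)
        rw [hl, List.length_cons] at this
        by_cases h : k = j + 1
        · subst h; rw [Function.update_self]; omega
        · rw [Function.update_of_ne h]; exact hv k
      · rw [Function.update_of_ne (by simp at hk; omega)]; exact hj k hk

end loops

end Backtrack

/-! ### Simulation of the oracle and of single steps -/

namespace Backtrack

open State Machine

variable {M V : Machine} {K J : ℕ}

local notation "𝔅" => machine M V K J

theorem next_oracle (hd : V.Deterministic) (hq : V.QueryFree) (q : M.Q) {c : V.Cfg}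
    (hc : ¬ V.Halted c) (m : ℕ → List Bool) (g u s t : List Bool) :
    Machine.next 𝔅 (cfg (oracle q c.state) m c.stk g u s t) =
      cfg (oracle q (V.next c).state) m (V.next c).stk g u s t := by
  obtain ⟨r, v⟩ := c
  cases hr : V.prog r with
  | push k b r' =>
    rw [show V.next ⟨r, v⟩ = _ from step_push hr _ _]
    exact next_push_oracle _ _ _ _ _ _ (by simp only [machine, hr])
  | pop k re r0 r1 =>
    have h : Machine.prog 𝔅 (oracle q r) =
      .pop (3 * k + 1) (oracle q re) (oracle q r0) (oracle q r1) := by simp only [machine, hr]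
    cases hk : v k with
    | nil =>
      rw [show V.next ⟨r, v⟩ = _ from step_pop_nil hr _ hk]
      exact next_pop_oracle_nil _ _ _ _ _ _ h hk
    | cons b l =>
      rw [show V.next ⟨r, v⟩ = _ from step_pop_cons hr _ hk]
      exact next_pop_oracle (f := fun b => oracle q (bif b then r1 else r0)) _ _ _ _ _ _ h hk
  | guess r0 r1 => exact absurd hr (hd _ _ _)
  | query k rn ry => exact absurd hr (hq _ _ _ _)
  | accept => exact absurd (Or.inl hr) hc
  | reject => exact absurd (Or.inr hr) hc

/-- A space-bounded run of `V` may be long, so no time bound is used: each simulated configuration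
is within `B` by itself. -/
theorem reaches_oracle (hd : V.Deterministic) (hq : V.QueryFree) (q : M.Q) {B n : ℕ} {c : V.Cfg}
    (hc : ∀ i < n, ¬ V.Halted (V.next^[i] c)) (hB : ∀ i, Within B (V.next^[i] c))
    {m : ℕ → List Bool} {g u s t : List Bool}
    (hm : ∀ k, (m k).length ≤ B) (hg : g.length ≤ B) (hu : u.length ≤ B)
    (hs : s.length ≤ B) (ht : t.length ≤ B) :
    Reaches (M := 𝔅) B (cfg (oracle q c.state) m c.stk g u s t)
      (cfg (oracle q (V.next^[n] c).state) m (V.next^[n] c).stk g u s t) := by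
  induction n generalizing c with
  | zero => exact .refl (within_cfg hm (hB 0) hg hu hs ht)
  | succ n ih =>
    exact .head (within_cfg hm (hB 0) hg hu hs ht)
      (next_oracle hd hq q (hc 0 (Nat.succ_pos n)) m g u s t)
      (ih (fun i hi => hc (i + 1) (by omega)) fun i => hB (i + 1))

/-- Once the machine for the oracle has halted, its answer is used and its stacks are emptied. -/
theorem reaches_of_halted (q : M.Q) {B : ℕ} {c : V.Cfg} (hc : V.Halted c) (ans : Bool)
    (ha : ans = true ↔ V.Accepting c) (hB : Within B c) (hJ : ∀ k, J < k → c.stk k = [])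
    {m : ℕ → List Bool} {g u s t : List Bool}
    (hm : ∀ k, (m k).length ≤ B) (hg : g.length ≤ B) (hu : u.length ≤ B)
    (hs : s.length ≤ B) (ht : t.length ≤ B) :
    Reaches (M := 𝔅) B (cfg (oracle q c.state) m c.stk g u s t)
      (cfg (sim (answer M q ans)) m (fun _ => []) g u s t) := by
  obtain ⟨r, v⟩ := c
  have h : Machine.prog 𝔅 (oracle q r) = .pop (3 * 0 + 1) (oracleWipe q ans (Fin.last J))
      (oracleWipe q ans (Fin.last J)) (oracleWipe q ans (Fin.last J)) := by
    rcases hc with hc | hc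
    · rw [ha.2 hc]
      simp only [machine, show V.prog r = _ from hc]
    · have : ans = false := by
        rw [← Bool.not_eq_true, ha]
        intro h
        rw [Accepting, hc] at h
        cases h
      rw [this]
      simp only [machine, show V.prog r = _ from hc]
  -- The pop that leaves the halted state may remove a letter from the first stack of `V`; the rest
  -- is erased in either case.
  cases hk : v 0 with
  | nil =>
    exact .head (within_cfg hm hB hg hu hs ht) (next_pop_oracle_nil _ _ _ _ _ _ h hk)
      (reaches_oracleWipe hm hg hu hs ht q ans _ v hB hJ)
  | cons b l =>
    refine .head (within_cfg hm hB hg hu hs ht)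
      (next_pop_oracle (f := fun _ => oracleWipe q ans (Fin.last J)) _ _ _ _ _ _ h hk)
      (reaches_oracleWipe hm hg hu hs ht q ans _ _ (fun k => ?_) fun k hJk => ?_)
    · by_cases e : k = 0
      · have := hB 0
        simp only [hk, List.length_cons] at this
        subst e; rw [Function.update_self]; omega
      · rw [Function.update_of_ne e]; exact hB k
    · rw [Function.update_of_ne (by simp at hJk; omega)]; exact hJ k hJk

/-- `V` is a machine for the oracle set `A` that uses only stacks up to `J`, and on queries of
length at most `N` stacks of length at most `E`. -/
structure Answers (V : Machine) (J : ℕ) (A : Set (List Bool)) (N E : ℕ) : Prop where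
  deterministic : V.Deterministic
  queryFree : V.QueryFree
  usesUpTo : V.UsesUpTo J
  exists_halted : ∀ x : List Bool, x.length ≤ N → ∃ n,
    (∀ m < n, ¬ V.Halted (V.next^[m] (V.init x))) ∧
      (∀ m, Within E (V.next^[m] (V.init x))) ∧
      V.Halted (V.next^[n] (V.init x)) ∧ (x ∈ A ↔ V.Accepting (V.next^[n] (V.init x)))

theorem iterate_next_eq_path (c : V.Cfg) (n : ℕ) :
    V.next^[n] c = V.path ∅ c (List.replicate n false) := by
  induction n generalizing c with
  | zero => rfl
  | succ n ih => rw [Function.iterate_succ_apply, ih]; rfl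

variable {A : Set (List Bool)} {N E B : ℕ}

open Classical in
-- Copying a word of length at most `N` back and forth takes at most `5 * N + 2` steps, starting
-- from stacks of length at most `N`; the run of `V` adds the bound `E`. Afterwards the stacks of
-- `V` are empty again, ready for the next query.
theorem Answers.reaches_query (hV : Answers V J A N E) {q qn qy : M.Q} {k : ℕ}
    (hq : M.prog q = .query k qn qy) (hB : 6 * N + 2 + E ≤ B) {m : ℕ → List Bool}
    {g u s : List Bool} (hm : ∀ k, (m k).length ≤ N) (hg : g.length ≤ N) (hu : u.length ≤ N)
    (hs : s.length ≤ N) :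
    Reaches (M := 𝔅) B (cfg (exec q) m (fun _ => []) g u s [])
      (cfg (sim (if m k ∈ A then qy else qn)) m (fun _ => []) g u s []) := by
  obtain ⟨n, h1, h2, h3, h4⟩ := hV.exists_halted (m k) (hm k)
  have e1 := steps_ask (V := V) (K := K) (J := J) hq m (fun _ => []) (m k) g u s []
  have e2 := steps_askBack (V := V) (K := K) (J := J) hq m [] [] g u s ((m k).reverse)
  simp only [Function.update_eq_self, List.append_nil] at e1
  simp only [List.length_reverse, List.reverse_reverse, List.append_nil, Function.update_eq_self,
    single_nil] at e2
  have e3 := (e1.trans e2).reaches (N := N) (B := B)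
    (within_cfg hm (by simp) hg hu hs (by simp)) (by have := hm k; omega)
  have b1 : ∀ k, (m k).length ≤ B := fun k => (hm k).trans (by omega)
  have b2 : g.length ≤ B := by omega
  have b3 : u.length ≤ B := by omega
  have b4 : s.length ≤ B := by omega
  have b5 : ([] : List Bool).length ≤ B := by simp
  have b6 : ∀ i, Within B (V.next^[i] (V.init (m k))) := fun i j => (h2 i j).trans (by omega)
  have e4 := reaches_oracle (M := M) (K := K) (J := J) hV.deterministic hV.queryFree q h1 b6
    b1 b2 b3 b4 b5
  have e5 := reaches_of_halted (M := M) (K := K) (J := J) q h3 (decide (m k ∈ A))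
    (by rw [← h4, decide_eq_true_iff]) (b6 n) (fun j hj => by
      rw [iterate_next_eq_path]
      exact hV.usesUpTo.path _ (fun i hi => init_stk_of_pos _ (by omega)) _ j hj) b1 b2 b3 b4 b5
  have e6 : answer M q (decide (m k ∈ A)) = if m k ∈ A then qy else qn := by
    rw [answer, hq]
    by_cases h : m k ∈ A <;> simp [h]
  rw [e6] at e5
  exact e3.trans (e4.trans e5)

/-- One step of `M` is simulated with a prescribed choice, or with the choice `false` if none is
prescribed. -/
theorem Answers.reaches_step (hV : Answers V J A N E) (hB : 6 * N + 10 + E ≤ B) {c : M.Cfg}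
    (hc : ¬ M.Halted c) {g g' u s : List Bool} {b : Bool}
    (hgb : g = b :: g' ∨ g = [] ∧ g' = [] ∧ b = false)
    (hm : ∀ k, (c.stk k).length ≤ N) (hg : g.length ≤ N) (hu : u.length < N) (hs : s.length ≤ N) :
    Reaches (M := 𝔅) B (cfg (sim c.state) c.stk (fun _ => []) g u s [])
      (cfg (sim (M.step A b c).state) (M.step A b c).stk (fun _ => []) g' (b :: u) s []) := by
  obtain ⟨q, m⟩ := c
  have hg' : g'.length ≤ N := by
    rcases hgb with rfl | ⟨rfl, rfl, rfl⟩
    · exact (Nat.le_succ _).trans hg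
    · exact hg
  have hsim : Machine.prog 𝔅 (sim q) = .pop 2 (mark q false) (mark q false) (mark q true) := by
    cases h : M.prog q with
    | accept => exact absurd (Or.inl h) hc
    | reject => exact absurd (Or.inr h) hc
    | _ => simp only [machine, h]
  have h1 : Machine.next 𝔅 (cfg (sim q) m (fun _ => []) g u s []) =
      cfg (mark q b) m (fun _ => []) g' u s [] := by
    rcases hgb with rfl | ⟨rfl, rfl, rfl⟩
    · exact next_pop_guide (f := mark q) _ _ _ _ _ _ hsim
    · exact next_pop_nil hsim rfl
  have h2 : Machine.next 𝔅 (cfg (mark q b) m (fun _ => []) g' u s []) =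
      cfg (afterMark M V K J q b) m (fun _ => []) g' (b :: u) s [] :=
    next_push_used _ _ _ _ _ _ rfl
  have hw : Within N (cfg (M := M) (V := V) (K := K) (J := J) (sim q) m (fun _ => []) g u s []) :=
    within_cfg hm (by simp) hg hu.le hs (by simp)
  have hstart := (Steps.one h1).trans (Steps.one h2)
  have fin : ∀ {c}, Machine.next 𝔅 (cfg (afterMark M V K J q b) m (fun _ => []) g' (b :: u) s []) =
      c → Reaches (M := 𝔅) B (cfg (sim q) m (fun _ => []) g u s []) c := fun h =>
    (hstart.trans (Steps.one h)).reaches hw (by omega)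
  cases hq : M.prog q with
  | push k a q' =>
    have ha : afterMark M V K J q b = exec q := by simp only [afterMark, hq]
    rw [ha] at fin
    rw [step_push hq]
    exact fin (next_push_sim _ _ _ _ _ _ (by simp only [machine, hq]))
  | pop k qe q0 q1 =>
    have ha : afterMark M V K J q b = exec q := by simp only [afterMark, hq]
    rw [ha] at fin
    have h : Machine.prog 𝔅 (exec q) = .pop (3 * k) (sim qe) (sim q0) (sim q1) := by
      simp only [machine, hq]
    cases hk : m k with
    | nil =>
      rw [step_pop_nil hq _ hk]
      exact fin (next_pop_sim_nil _ _ _ _ _ _ h hk)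
    | cons a l =>
      rw [step_pop_cons hq _ hk]
      exact fin (next_pop_sim (f := fun a => sim (bif a then q1 else q0)) _ _ _ _ _ _ h hk)
  | guess q0 q1 =>
    have ha : afterMark M V K J q b = sim (if b then q1 else q0) := by simp only [afterMark, hq]
    rw [ha] at hstart
    rw [step_guess hq]
    exact hstart.reaches hw (by omega)
  | query k qn qy =>
    have ha : afterMark M V K J q b = exec q := by simp only [afterMark, hq]
    rw [ha] at hstart
    rw [step_query hq]
    exact (hstart.reaches hw (by omega)).trans
      (hV.reaches_query hq (by omega) hm hg' (by simpa using hu) hs)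
  | accept => exact absurd (Or.inl hq) hc
  | reject => exact absurd (Or.inr hq) hc

/-- The configuration in which the path `u` has been simulated and the choices `g` are prescribed
for its continuation. -/
noncomputable def node (V : Machine) (K J : ℕ) (A : Set (List Bool)) (x g u : List Bool) :
    (machine M V K J).Cfg :=
  cfg (sim (M.path A (M.init x) u).state) (M.path A (M.init x) u).stk (fun _ => []) g u.reverse x []

/-! ### Depth-first search of the computation tree -/

section search

variable {x : List Bool} {T : ℕ}

/-- No proper prefix of `u` leads to a halted configuration. -/
def Live (M : Machine) (A : Set (List Bool)) (x u : List Bool) : Prop :=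
  ∀ v, v <+: u → v ≠ u → ¬ M.Halted (M.path A (M.init x) v)

theorem Answers.reaches_node (hV : Answers V J A N E) (hB : 6 * N + 10 + E ≤ B)
    (hN : N = x.length + T) {g g' u : List Bool} {b : Bool}
    (hgb : g = b :: g' ∨ g = [] ∧ g' = [] ∧ b = false)
    (hu : ¬ M.Halted (M.path A (M.init x) u)) (hT : u.length + g.length ≤ T) (hT' : u.length < T) :
    Reaches (M := 𝔅) B (node V K J A x g u) (node V K J A x g' (u ++ [b])) := by
  have := hV.reaches_step (M := M) (K := K) (B := B) hB hu (u := u.reverse) (s := x) hgb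
    (fun k => (length_path_le _ (length_init_le x) u k).trans (by omega)) (by omega)
    (by rw [List.length_reverse]; omega) (by omega)
  unfold node
  rw [path_concat, List.reverse_append]
  exact this

theorem Answers.within_node (hB : 6 * N + 10 + E ≤ B) (hN : N = x.length + T) {g u : List Bool}
    (hT : u.length + g.length ≤ T) : Within B (node (M := M) V K J A x g u) :=
  within_cfg (fun k => (length_path_le _ (length_init_le x) u k).trans (by omega)) (by simp)
    (by omega) (by rw [List.length_reverse]; omega) (by omega) (by simp)

/-- A halted configuration inside the replayed stretch would make the machine reject or backtrack
with choices still pending; `Live` excludes this. -/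
theorem Answers.reaches_replay (hV : Answers V J A N E) (hB : 6 * N + 10 + E ≤ B)
    (hN : N = x.length + T) (g u : List Bool) (hl : Live M A x (u ++ g))
    (hT : u.length + g.length ≤ T) :
    Reaches (M := 𝔅) B (node V K J A x g u) (node V K J A x [] (u ++ g)) := by
  induction g generalizing u with
  | nil =>
    rw [List.append_nil]
    exact .refl (within_node hB hN hT)
  | cons b g ih =>
    rw [List.length_cons] at hT
    have e : u ++ b :: g = u ++ [b] ++ g := by simp
    have h := hl u (List.prefix_append _ _) (by simp)
    refine (hV.reaches_node hB hN (Or.inl rfl) h (by simpa using hT) (by omega)).trans ?_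
    rw [e] at hl ⊢
    exact ih _ hl (by simp only [List.length_append, List.length_singleton]; omega)

/-- The search restarts with the choices `u` followed by `true`. -/
theorem reaches_restart (hB : 8 * N + 10 + E ≤ B) (hN : N = x.length + T) (u : List Bool)
    (hT : u.length < T) :
    Reaches (M := 𝔅) B (cfg back (fun _ => []) (fun _ => []) [] (u ++ [false]).reverse x [])
      (node V K J A x (u ++ [true]) []) := by
  have h1 : Machine.next 𝔅 (cfg back (fun _ => []) (fun _ => []) [] (false :: u.reverse) x []) =
      cfg turn (fun _ => []) (fun _ => []) [] u.reverse x [] :=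
    next_pop_used (f := fun b => bif b then back else turn) _ _ _ _ _ _ rfl
  have h2 : Machine.next 𝔅 (cfg turn (fun _ => []) (fun _ => []) [] u.reverse x []) =
      cfg rewind (fun _ => []) (fun _ => []) [true] u.reverse x [] :=
    next_push_guide _ _ _ _ _ _ rfl
  have h3 := steps_rewind (M := M) (V := V) (K := K) (J := J) (fun _ => []) (fun _ => []) [true]
    u.reverse x []
  have h4 := steps_reload (M := M) (V := V) (K := K) (J := J) (fun _ => []) (fun _ => [])
    (u ++ [true]) [] x []
  have h5 := steps_distribute (M := M) (V := V) (K := K) (J := J) (fun _ => []) [] (u ++ [true]) []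
    [] x.reverse
  rw [List.reverse_reverse] at h3
  simp only [List.append_nil] at h4
  simp only [List.reverse_reverse, List.append_nil, single_nil] at h5
  rw [List.reverse_append]
  -- The run has `2 * u.length + 5 * x.length + 5` steps: two for the turn, one pass over the
  -- choices and two over the input.
  refine ((((Steps.one h1).trans (Steps.one h2)).trans h3).trans h4 |>.trans h5).reaches (N := N)
    (within_cfg (by simp) (by simp) (by simp) ?_ (by omega) (by simp)) ?_
  · simp; omega
  · simp only [List.length_reverse]; omega

/-- The search below the path `u` either finds an accepting path and rejects, or there is none and
the search leaves the subtree. -/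
theorem Answers.search (hV : Answers V J A N E) (hK : M.UsesUpTo K) (hB : 8 * N + 10 + E ≤ B)
    (hN : N = x.length + T) (hT : ∀ u : List Bool, u.length = T → M.Halted (M.path A (M.init x) u))
    (d : ℕ) (u : List Bool) (hd : u.length + d = T) (hl : Live M A x u) :
    ((∃ v, M.Accepting (M.path A (M.init x) (u ++ v))) ∧
      ∃ c, Reaches (M := 𝔅) B (node V K J A x [] u) c ∧ Machine.prog 𝔅 c.state = .reject) ∨
    ((∀ v, ¬ M.Accepting (M.path A (M.init x) (u ++ v))) ∧
      Reaches (M := 𝔅) B (node V K J A x [] u)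
        (cfg back (fun _ => []) (fun _ => []) [] u.reverse x [])) := by
  -- `d` is the depth left below `u`; at depth `T` every path has halted.
  induction d generalizing u with
  | zero => exact halted_case u (by omega) (hT u hd)
  | succ d ih =>
    by_cases hu : M.Halted (M.path A (M.init x) u)
    · exact halted_case u (by omega) hu
    have hl' : ∀ b, Live M A x (u ++ [b]) := by
      intro b v hv hne
      rcases List.prefix_concat_iff.1 hv with h | h
      · exact absurd h hne
      · by_cases e : v = u
        · rwa [e]
        · exact hl v h e
    -- With nothing prescribed, the child reached by the choice `false` is visited first.
    have h0 : Reaches (M := 𝔅) B (node V K J A x [] u) (node V K J A x [] (u ++ [false])) :=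
      hV.reaches_node (by omega) hN (Or.inr ⟨rfl, rfl, rfl⟩) hu (by simp; omega) (by omega)
    have h1 : Reaches (M := 𝔅) B (node V K J A x (u ++ [true]) []) (node V K J A x [] (u ++ [true])) :=
      hV.reaches_replay (by omega) hN (u ++ [true]) [] (hl' true) (by simp; omega)
    rcases ih (u ++ [false]) (by simp; omega) (hl' false) with ⟨⟨v, hv⟩, c, hc, hr⟩ | ⟨hf, hb⟩
    · exact Or.inl ⟨⟨false :: v, by simpa using hv⟩, c, h0.trans hc, hr⟩
    -- The first subtree has been left without success; the path to the second child is rerun from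
    -- the input.
    have h2 := (h0.trans hb).trans ((reaches_restart hB hN u (by omega)).trans h1)
    rcases ih (u ++ [true]) (by simp; omega) (hl' true) with ⟨⟨v, hv⟩, c, hc, hr⟩ | ⟨ht, hb'⟩
    · exact Or.inl ⟨⟨true :: v, by simpa using hv⟩, c, h2.trans hc, hr⟩
    right
    refine ⟨fun v hv => ?_, (h2.trans hb').trans ?_⟩
    · match v with
      | [] =>
        rw [List.append_nil] at hv
        exact hu hv.halted
      | false :: v => exact hf v (by simpa using hv)
      | true :: v => exact ht v (by simpa using hv)
    · have h3 : Machine.next 𝔅 (cfg back (fun _ => []) (fun _ => []) [] (true :: u.reverse) x []) =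
          cfg back (fun _ => []) (fun _ => []) [] u.reverse x [] :=
        next_pop_used (f := fun b => bif b then back else turn) _ _ _ _ _ _ rfl
      rw [List.reverse_append]
      refine (Steps.one h3).reaches (N := N + 1)
        (within_cfg (by simp) (by simp) (by simp) ?_ (by omega) (by simp)) (by omega)
      simp; omega
where
  halted_case (u : List Bool) (hlen : u.length ≤ T) (hu : M.Halted (M.path A (M.init x) u)) :
      ((∃ v, M.Accepting (M.path A (M.init x) (u ++ v))) ∧
        ∃ c, Reaches (M := 𝔅) B (node V K J A x [] u) c ∧ Machine.prog 𝔅 c.state = .reject) ∨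
      ((∀ v, ¬ M.Accepting (M.path A (M.init x) (u ++ v))) ∧
        Reaches (M := 𝔅) B (node V K J A x [] u)
          (cfg back (fun _ => []) (fun _ => []) [] u.reverse x [])) := by
    have hw : Within B (node (M := M) V K J A x [] u) :=
      within_node (E := E) (N := N) (by omega) hN (by simpa using hlen)
    rcases hu with h | h
    · refine Or.inl ⟨⟨[], by rw [List.append_nil]; exact h⟩, _, .refl hw, ?_⟩
      change Machine.prog 𝔅 (sim (M.path A (M.init x) u).state) = _
      simp only [machine, h]
    · have hp : Machine.prog 𝔅 (sim (M.path A (M.init x) u).state) =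
          .pop (3 * 0) (wipe (Fin.last K)) (wipe (Fin.last K)) (wipe (Fin.last K)) := by
        simp only [machine, h]
      have hlen' : ∀ k, ((M.path A (M.init x) u).stk k).length ≤ B := fun k =>
        (length_path_le _ (length_init_le x) u k).trans (by omega)
      -- Stacks above `K` have never been touched, so erasing from `K` downwards empties all of
      -- them.
      have hempty := hK.path (A := A) (M.init x) (fun k hk => init_stk_of_pos x (by omega)) u
      refine Or.inr ⟨fun v hv => ?_, ?_⟩
      · rw [path_append, path_of_halted (Or.inr h), Accepting, h] at hv
        cases hv
      · cases hk : (M.path A (M.init x) u).stk 0 with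
        | nil =>
          exact .head hw (next_pop_sim_nil _ _ _ _ _ _ hp hk)
            (reaches_wipe (by simp) (by rw [List.length_reverse]; omega) (by omega) (by simp) _ _
              hlen' hempty)
        | cons b l =>
          refine .head hw (next_pop_sim (f := fun _ => wipe (Fin.last K)) _ _ _ _ _ _ hp hk)
            (reaches_wipe (by simp) (by rw [List.length_reverse]; omega) (by omega) (by simp) _ _
              (fun k => ?_) fun k hKk => ?_)
          · by_cases e : k = 0
            · have := hlen' 0
              rw [hk, List.length_cons] at this
              subst e; rw [Function.update_self]; omega
            · rw [Function.update_of_ne e]; exact hlen' k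
          · rw [Function.update_of_ne (by simp at hKk; omega)]; exact hempty k hKk

/-- The backtracking machine accepts iff no path of `M` accepts. -/
theorem Answers.reaches_halted (hV : Answers V J A N E) (hK : M.UsesUpTo K)
    (hB : 8 * N + 10 + E ≤ B) (hN : N = x.length + T)
    (hT : ∀ u : List Bool, u.length = T → M.Halted (M.path A (M.init x) u)) :
    ∃ c, Reaches (M := 𝔅) B (Machine.init 𝔅 x) c ∧ Machine.Halted 𝔅 c ∧
      (Machine.Accepting 𝔅 c ↔ ∀ u, ¬ M.Accepting (M.path A (M.init x) u)) := by
  have e0 : Machine.init 𝔅 x = cfg load (single x) (fun _ => []) [] [] [] [] := by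
    have h0 : (fun _ => [] : ℕ → List Bool) = store (fun _ => []) (fun _ => []) [] [] [] [] := by
      apply store_ext <;> intro k
      · rw [store_sim]
      · rw [store_oracle]
      · rw [store_aux]; unfold aux; split <;> rfl
    have h1 : Function.update (fun _ => []) 0 x = store (single x) (fun _ => []) [] [] [] [] :=
      (congrArg (fun f => Function.update f 0 x) h0).trans (update_store_sim _ _ _ _ _ _ x 0)
    exact congrArg (Cfg.mk (M := 𝔅) load) h1
  have h1 := steps_load (M := M) (V := V) (K := K) (J := J) (fun _ => []) x [] [] [] []
  have h2 := steps_distribute (M := M) (V := V) (K := K) (J := J) (fun _ => []) [] [] [] []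
    x.reverse
  simp only [List.append_nil] at h1
  simp only [List.reverse_reverse, List.append_nil] at h2
  have h3 : Reaches (M := 𝔅) B (Machine.init 𝔅 x) (node V K J A x [] []) := by
    rw [e0]
    refine (h1.trans h2).reaches (N := N) (within_cfg (fun k => ?_) (by simp) (by simp) (by simp)
      (by simp) (by simp)) ?_
    · exact (length_single_le x k).trans (by omega)
    · rw [List.length_reverse]; omega
  rcases hV.search hK hB hN hT T [] (by simp) (fun v hv hne => absurd (List.prefix_nil.1 hv) hne)
    with ⟨⟨v, hv⟩, c, hc, hr⟩ | ⟨hno, hb⟩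
  · refine ⟨c, h3.trans hc, Or.inr hr, iff_of_false (fun h => ?_) fun h => h v hv⟩
    rw [Accepting, hr] at h
    cases h
  · have h4 : Machine.next 𝔅 (cfg back (fun _ => []) (fun _ => []) [] [] x []) =
        cfg acc (fun _ => []) (fun _ => []) [] [] x [] := next_pop_nil rfl rfl
    refine ⟨_, (h3.trans hb).trans ((Steps.one h4).reaches (N := N)
      (within_cfg (by simp) (by simp) (by simp) (by simp) (by omega) (by simp)) (by omega)),
      Or.inl rfl, iff_of_true rfl hno⟩

end search

end Backtrack

/-! ### The inclusion of coNP with a PSPACE oracle in PSPACE -/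

namespace Complexity

/-- The coefficients are natural numbers. Monotonicity gives one space bound for all queries up to a
given length. -/
theorem eval_mono (p : Polynomial ℕ) {a b : ℕ} (h : a ≤ b) : p.eval a ≤ p.eval b := by
  rw [Polynomial.eval_eq_sum_range, Polynomial.eval_eq_sum_range]
  exact Finset.sum_le_sum fun i _ => Nat.mul_le_mul_left _ (Nat.pow_le_pow_left h i)

/-- Polynomial space is closed under nondeterministic polynomial time with an oracle. -/
theorem co_NPrel_PSPACE_subset : co (NPrel PSPACE) ⊆ PSPACE := by
  rintro L ⟨A, ⟨V, hd, hq, p, hp⟩, M, r, hr⟩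
  obtain ⟨K, hK⟩ := M.exists_usesUpTo
  obtain ⟨J, hJ⟩ := V.exists_usesUpTo
  refine ⟨Backtrack.machine M V K J, Backtrack.machine_deterministic M V K J,
    Backtrack.machine_queryFree M V K J,
    .of_reaches (Backtrack.machine_deterministic M V K J)
      -- A run of `r` steps keeps all stacks of `M`, and hence all query words, within `X + r`; on
      -- such words `V` needs space at most `p` of that length.
      (8 * (Polynomial.X + r) + 10 + p.comp (Polynomial.X + r)) fun x => ?_⟩
  have hV : Backtrack.Answers V J A (x.length + r.eval x.length)
      (p.eval (x.length + r.eval x.length)) := by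
    refine ⟨hd, hq, hJ, fun y hy => ?_⟩
    obtain ⟨n, h1, h2, h3⟩ := Machine.DecidesInPolySpace.exists_halted hd (hp y)
    exact ⟨n, h1, fun m k => (h2 m k).trans (eval_mono p hy), h3⟩
  obtain ⟨hh, hx⟩ := hr x
  simp only [Machine.run_eq_runFrom] at hh hx
  have hT : ∀ u : List Bool, u.length = r.eval x.length →
      M.Halted (M.path A (M.init x) u) := by
    intro u hu
    obtain ⟨w, hw⟩ := M.exists_runFrom_eq_path (A := A) (M.init x) u
    rw [← hw, hu]
    exact hh w
  obtain ⟨c, h1, h2, h3⟩ := hV.reaches_halted hK le_rfl rfl hT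
  refine ⟨c, ?_, h2, ?_⟩
  · simpa using h1
  · rw [h3, ← not_iff_not, ← Set.mem_compl_iff, hx]
    push Not
    constructor
    · rintro ⟨w, hw⟩
      exact ⟨_, by rwa [Machine.runFrom_eq_path] at hw⟩
    · rintro ⟨u, hu⟩
      obtain ⟨w, hw⟩ := M.exists_runFrom_eq_path (A := A) (M.init x) u
      refine ⟨w, ?_⟩
      rw [← hw] at hu
      -- The accepting path `u` may have any length. A shorter one keeps its accepting configuration
      -- up to the time bound; a longer one had already halted there.
      rcases le_total u.length (r.eval x.length) with h | h
      · rwa [Machine.runFrom_of_le h hu.halted]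
      · rwa [← Machine.runFrom_of_le h (hh w)]

end Complexity

theorem mainTheorem5 (LOG : SequentCalculus) :
    (LOG.sequentValidity.InClass Complexity.NP →
      LOG.nashEquilibrium.InClass (Complexity.co (Complexity.NPrel Complexity.BH2)) ∧
      LOG.nashEquilibrium.InClass (Complexity.PiP 2)) ∧
    (LOG.sequentValidity.InClass Complexity.PSPACE →
      LOG.nashEquilibrium.InClass Complexity.PSPACE) :=
  ⟨fun h => ⟨Deviation.nashEquilibrium_inClass (h.mono Complexity.NP_subset_BH2),
    -- `PiP 2` unfolds to `co (NPrel (NPrel P))`, so the oracle class is `NPrel P`.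
    Deviation.nashEquilibrium_inClass (h.mono Complexity.NP_subset_NPrel_P)⟩,
    fun h => (Deviation.nashEquilibrium_inClass h).mono Complexity.co_NPrel_PSPACE_subset⟩
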